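/- **Setting.** Consider a hidden Markov model with $n$ observations, $m$ hidden states, transition matrix $T\in\mathbb R^{m\times m}$ and observation matrix $O\in\mathbb R^{n\times m}$, both of rank $m$, and an initial distribution with all entries positive. Let $k<m$. For $a,b,c\in[n]$ let $q(a,b,c)=\Pr(x_1=a,x_2=b,x_3=c)$, and put $[P_1]_i=\Pr(x_1=i)$, $[P_{2,1}]_{ij}=\Pr(x_2=i,x_1=j)$, $[P_{3,x,1}]_{ij}=\Pr(x_3=i,x_2=x,x_1=j)$. From $N$ independent copies of the triplet $(x_1,x_2,x_3)$ form the empirical frequencies $\widehat P_1,\widehat P_{2,1},\widehat P_{3,x,1}$. For families $R=(R_x)_{x\in[n]}$, $S=(S_x)_{x\in[n]}$ of real $n\times k$ matrices let $$M_N(R,S)=\sum_{x,i,j\in[n]}\big([\widehat P_{3,x,1}]_{ij}-[R_xS_x^\top\widehat P_{2,1}]_{ij}\big)^2,$$ and let $M(R,S)$ be the same expression with the true $P_{3,x,1},P_{2,1}$. Assume that the target is identified, i.e. all minimisers of $M$ have the same products $R_xS_x^\top=B^*_x$ ($x\in[n]$), and that $\operatorname{rank}B^*_x=k$ for all $x$.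 (The low-rank model need not be correctly specified.) Put $\theta^*=(P_1,B^*,\mathbf 1)$. Let $\lambda>0$, and let $P_\alpha$ be a locally Lipschitz real function of $(R,S)$ such that 1. $P_\alpha$ is bounded below, and for each $c$ there is $K$ such that every $(R,S)$ with $P_\alpha(R,S)\le c$ and all entries of all $R_xS_x^\top$ at most $c$ in absolute value can be replaced by some $(R',S')$ of norm at most $K$ with the same products $R'_xS_x'^\top=R_xS_x^\top$ and $P_\alpha(R',S')\le P_\alpha(R,S)$ (for instance, $P_\alpha$ is coercive); 2. $P_\alpha$ has a direction of linear descent at every $\theta=(R,S)$ that minimises $P_\alpha$ among the factorisations of $B^*$: there are $v$ and $c>0$ with $P_\alpha(\theta'+tv)\le P_\alpha(\theta')-ct$ for all $\theta'$ close to $\theta$ and all small $t>0$ (for $P_\alpha\in C^1$: $\nabla P_\alpha(\theta)\ne0$; for convex $P_\alpha$: $\theta$ is not a global minimiser of $P_\alpha$). For $p>0$ let $\widehat\theta^{(p)}_N=(\widehat P_1,(\widehat R_x\widehat S_x^\top)_x,\mathbf 1)$, where $(\widehat R,\widehat S)$ minimises, with probability tending to one, $$M_N(R,S)+\lambda N^{-p}P_\alpha(R,S),$$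 and let $\widehat\theta_N$ be the unpenalised low-rank M-estimator, built in the same way from a minimiser of $M_N$. Two estimators are said to have the same convergence rate if, for every real sequence $(s_N)$, $s_N\|\widehat\theta-\theta^*\|$ is bounded in probability for the one if and only if it is for the other. **Proposition.** The unpenalised estimator has convergence rate exactly $\sqrt N$: for every real sequence $(s_N)$, $s_N\|\widehat\theta_N-\theta^*\|=O_P(1)$ if and only if $s_N=O(\sqrt N)$. For $p>0$, the penalised estimator $\widehat\theta^{(p)}_N$ has the same convergence rate as $\widehat\theta_N$ if and only if $p\ge 1/2$. Thus the smallest exponent $p$ (the slowest decay $N^{-p}$ of the penalty) for which the convergence rate is unchanged is $p=1/2$. -/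

import Mathlib

open MeasureTheory ProbabilityTheory Filter Topology

noncomputable section

/-- A hidden Markov model with `n` observations and `m` hidden states:
`T i j = Pr(h_{t+1} = i | h_t = j)`, `O i j = Pr(x_t = i | h_t = j)`, and `init` is the
distribution of the first hidden state. -/
structure HMM (n m : ℕ) where
  T : Matrix (Fin m) (Fin m) ℝ
  O : Matrix (Fin n) (Fin m) ℝ
  init : Fin m → ℝ
  T_nonneg : ∀ i j, 0 ≤ T i j
  T_sum : ∀ j, ∑ i, T i j = 1
  O_nonneg : ∀ i j, 0 ≤ O i j
  O_sum : ∀ j, ∑ i, O i j = 1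
  init_nonneg : ∀ j, 0 ≤ init j
  init_sum : ∑ j, init j = 1

/-- The table `(a, b, c) ↦ Pr(x_1 = a, x_2 = b, x_3 = c)` of a hidden Markov model. -/
def HMM.tripleProb {n m : ℕ} (M : HMM n m) (a b c : Fin n) : ℝ :=
  ∑ h₁, ∑ h₂, ∑ h₃,
    M.init h₁ * M.O a h₁ * M.T h₂ h₁ * M.O b h₂ * M.T h₃ h₂ * M.O c h₃

/-- The empirical table: the proportion of the first `N` triplets equal to `(a, b, c)`. -/
def empiricalTable {n : ℕ} {Ω : Type*} (X : ℕ → Ω → Fin n × Fin n × Fin n) (N : ℕ) (ω : Ω)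
    (a b c : Fin n) : ℝ :=
  (((Finset.range N).filter (fun l => X l ω = (a, b, c))).card : ℝ) / (N : ℝ)

/-- `[P₁]_i = Pr(x_1 = i)`, from the table `q` of the joint law of `(x_1, x_2, x_3)`. -/
def P1 {n : ℕ} (q : Fin n → Fin n → Fin n → ℝ) (i : Fin n) : ℝ :=
  ∑ b, ∑ c, q i b c

/-- `[P₂₁]_{ij} = Pr(x_2 = i, x_1 = j)`. -/
def P21 {n : ℕ} (q : Fin n → Fin n → Fin n → ℝ) : Matrix (Fin n) (Fin n) ℝ :=
  Matrix.of fun i j => ∑ c, q j i c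

/-- `[P₃ₓ₁]_{ij} = Pr(x_3 = i, x_2 = x, x_1 = j)`. -/
def P3x1 {n : ℕ} (q : Fin n → Fin n → Fin n → ℝ) (x : Fin n) : Matrix (Fin n) (Fin n) ℝ :=
  Matrix.of fun i j => q j x i

/-- The space of pairs `(R, S)` of families of `n × k` matrices `R_x`, `S_x`, `x ∈ [n]`
(a finite-dimensional real vector space, with the sup norm of the entries). -/
abbrev Factors (n k : ℕ) : Type :=
  (Fin n → Fin n → Fin k → ℝ) × (Fin n → Fin n → Fin k → ℝ)

/-- The family of matrices `B_x = R_x S_xᵀ`. -/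
def Factors.prod {n k : ℕ} (θ : Factors n k) (x : Fin n) : Matrix (Fin n) (Fin n) ℝ :=
  Matrix.of (θ.1 x) * (Matrix.of (θ.2 x)).transpose

/-- The low-rank criterion `∑_{x,i,j} ([P₃ₓ₁]_{ij} - [R_x S_xᵀ P₂₁]_{ij})²`: with the empirical
table it is `M_N(R, S)`, with the true table it is the limit `M(R, S)`. -/
def criterion {n k : ℕ} (q : Fin n → Fin n → Fin n → ℝ) (θ : Factors n k) : ℝ :=
  ∑ x, ∑ i, ∑ j, (P3x1 q x i j - (θ.prod x * P21 q) i j) ^ 2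

/-- The penalised criterion `M_N(R, S) + λ N^{-p} P(R, S)`. -/
def penalizedCriterion {n k : ℕ} (q : Fin n → Fin n → Fin n → ℝ) (P : Factors n k → ℝ)
    (lam p : ℝ) (N : ℕ) (θ : Factors n k) : ℝ :=
  criterion q θ + lam * (N : ℝ) ^ (-p) * P θ

/-- `θ` is a global minimiser of `f`. -/
def IsMinimizer {α : Type*} (f : α → ℝ) (θ : α) : Prop := ∀ θ', f θ ≤ f θ'

/-- `B` is the identified target of low-rank estimation for the table `q`: the limiting
criterion has a minimiser, and all its minimisers give the same products `R_x S_xᵀ = B_x`. -/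
def IsLowRankTarget {n : ℕ} (k : ℕ) (q : Fin n → Fin n → Fin n → ℝ)
    (B : Fin n → Matrix (Fin n) (Fin n) ℝ) : Prop :=
  (∃ θ : Factors n k, IsMinimizer (criterion q) θ) ∧
    ∀ θ : Factors n k, IsMinimizer (criterion q) θ → θ.prod = B

/-- The parameter triplet `(b₁, B, b_∞)`. -/
structure Triplet (n : ℕ) where
  b1 : Fin n → ℝ
  B : Fin n → Matrix (Fin n) (Fin n) ℝ
  binf : Fin n → ℝ

/-- Euclidean distance of two parameter triplets. -/
def Triplet.distance {n : ℕ} (s t : Triplet n) : ℝ :=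
  Real.sqrt ((∑ i, (s.b1 i - t.b1 i) ^ 2) + (∑ x, ∑ i, ∑ j, (s.B x i j - t.B x i j) ^ 2)
    + ∑ i, (s.binf i - t.binf i) ^ 2)

/-- The triplet `(P₁, B, 𝟏)` built from a table and a family `B`: with the empirical table and
the minimising `B` it is the estimator, with the true table and the target `B` the estimand. -/
def tripletOf {n : ℕ} (q : Fin n → Fin n → Fin n → ℝ) (B : Fin n → Matrix (Fin n) (Fin n) ℝ) :
    Triplet n :=
  ⟨P1 q, B, fun _ => 1⟩

/-- The error `‖θ̂_N - θ*‖` of the estimator `θ̂_N = (P̂₁, (R̂_x Ŝ_xᵀ)_x, 𝟏)` built from the factors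
`θ N ω = (R̂, Ŝ)`, with `θ* = (P₁, B, 𝟏)` for the true table `q`. -/
def estimationError {n k : ℕ} {Ω : Type*} (X : ℕ → Ω → Fin n × Fin n × Fin n)
    (q : Fin n → Fin n → Fin n → ℝ) (B : Fin n → Matrix (Fin n) (Fin n) ℝ)
    (θ : ℕ → Ω → Factors n k) (N : ℕ) (ω : Ω) : ℝ :=
  (tripletOf (empiricalTable X N ω) (θ N ω).prod).distance (tripletOf q B)

/-- `Z_N = O_P(1)`: the sequence is bounded in probability. -/
def BoundedInProb {Ω : Type*} [MeasurableSpace Ω] (μ : Measure Ω) (Z : ℕ → Ω → ℝ) : Prop :=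
  ∀ ε : ℝ, 0 < ε → ∃ K : ℝ, ∀ᶠ N in atTop, μ {ω | K < |Z N ω|} ≤ ENNReal.ofReal ε

/-- The errors `Z_N` have convergence rate exactly `r_N`: `s_N Z_N = O_P(1)` holds for the
sequences `s = O(r)`, and for no others. -/
def HasRate {Ω : Type*} [MeasurableSpace Ω] (μ : Measure Ω) (Z : ℕ → Ω → ℝ) (r : ℕ → ℝ) : Prop :=
  ∀ s : ℕ → ℝ, BoundedInProb μ (fun N ω => s N * Z N ω) ↔ s =O[atTop] r

/-- Two error sequences have the same convergence rate: multiplied by any sequence `s_N`, either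
both are bounded in probability or neither is. -/
def SameRate {Ω : Type*} [MeasurableSpace Ω] (μ : Measure Ω) (Z Z' : ℕ → Ω → ℝ) : Prop :=
  ∀ s : ℕ → ℝ,
    BoundedInProb μ (fun N ω => s N * Z N ω) ↔ BoundedInProb μ (fun N ω => s N * Z' N ω)

/-- The penalty is bounded below, and its sublevel sets are bounded up to a change of the
factorisation: a pair with `P(R, S) ≤ c` and products bounded by `c` can be replaced by one of
norm at most `K(c)` with the same products and no larger penalty. Every coercive continuous
penalty satisfies this, and so does every one that is bounded below and depends on the products
`R_x S_xᵀ` only. -/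
def IsProperPenalty {n k : ℕ} (P : Factors n k → ℝ) : Prop :=
  BddBelow (Set.range P) ∧
    ∀ c : ℝ, ∃ K : ℝ, ∀ θ : Factors n k, P θ ≤ c → (∀ x i j, |θ.prod x i j| ≤ c) →
      ∃ θ' : Factors n k, θ'.prod = θ.prod ∧ P θ' ≤ P θ ∧ ‖θ'‖ ≤ K

/-- `θ` is a factorisation of the family `B` with the least penalty. -/
def IsCheapestFactorization {n k : ℕ} (P : Factors n k → ℝ)
    (B : Fin n → Matrix (Fin n) (Fin n) ℝ) (θ : Factors n k) : Prop :=
  θ.prod = B ∧ ∀ θ' : Factors n k, θ'.prod = B → P θ ≤ P θ'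

/-- The penalty decreases at a linear rate in some direction, uniformly near `θ` (that is, `0` is
not in the Clarke subdifferential of the locally Lipschitz function `P` at `θ`; for `P` of class
`C¹` it says that the gradient at `θ` is not `0`, for convex `P` that `θ` does not minimise `P`). -/
def HasDescentDirection {n k : ℕ} (P : Factors n k → ℝ) (θ : Factors n k) : Prop :=
  ∃ v : Factors n k, ∃ c : ℝ, 0 < c ∧
    ∀ᶠ z in 𝓝 θ ×ˢ 𝓝[>] (0 : ℝ), P (z.1 + z.2 • v) ≤ P z.1 - c * z.2

end

noncomputable section

open Matrix

/-! Let d be the distance of the products R_x S_xᵀ from the target B*. The proof rests on the fact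
that the excess of the limiting criterion over its minimum is of exact order d²: at least c d²
everywhere (`criterion_growth`) and at most C d² near a factorisation of B*
(`exists_criterion_upper`). Lower bound: identification and rank k force P₂₁ to be invertible
(`det_P21_ne_zero`), so B*_x P₂₁ is the unique best approximation of P₃ₓ₁ of rank at most k.
Uniqueness opens a gap between the k-th and the next singular value, and the gap yields quadratic
growth (`frobSq_sub_growth`). Upper bound: a nearby pair is within O(d) of an exact factorisation of
B* (`exists_retraction`), and the criterion is stationary when only one of its two factors moves.

A table at distance Δ from the true one changes the increments of the criterion by O(Δ(d + d²)). For
a minimiser θ with penalty weight τ, comparison with a factorisation θ' of B* gives c d² ≲ Δ d + τ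
(P(θ') - P(θ)). The retraction and the Lipschitz property provide a θ' with P(θ') - P(θ) = O(d),
hence d = O(Δ + τ) (`exists_minimizer_error_bound`). By the central limit theorem Δ is
O_P(N^{-1/2}), so weights O(N^{-1/2}) keep the rate. No faster rate is possible, because the
component P̂₁ already fluctuates at scale N^{-1/2}.

If p < 1/2 and the error were still O_P(N^{-1/2}), bounded minimisers would accumulate at a cheapest
factorisation of B*. A step of length N^{-1/2} in a descent direction there costs O(1/N) in the
criterion and gains order N^{-p-1/2} in the penalty, which contradicts minimality
(`not_eventually_exists_fast_minimizer`). -/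

/-- The squared Frobenius norm of a real matrix. -/
def frobSq {ι κ : Type*} [Fintype ι] [Fintype κ] (X : Matrix ι κ ℝ) : ℝ :=
  ∑ i, ∑ j, X i j ^ 2

/-! ### Frobenius norm and orthonormal bases of row spaces -/

section Frobenius

variable {ι κ τ : Type*} [Fintype ι] [Fintype κ] [Fintype τ]

theorem frobSq_eq_trace (X : Matrix ι κ ℝ) : frobSq X = (X * Xᵀ).trace := by
  simp [frobSq, Matrix.trace, Matrix.mul_apply, sq]

theorem frobSq_transpose (X : Matrix ι κ ℝ) : frobSq Xᵀ = frobSq X := by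
  simp only [frobSq, transpose_apply]
  exact Finset.sum_comm

theorem frobSq_eq_trace' (X : Matrix ι κ ℝ) : frobSq X = (Xᵀ * X).trace := by
  rw [frobSq_eq_trace, trace_mul_comm]

theorem frobSq_nonneg (X : Matrix ι κ ℝ) : 0 ≤ frobSq X :=
  Finset.sum_nonneg fun _ _ => Finset.sum_nonneg fun _ _ => sq_nonneg _

theorem sq_le_frobSq (X : Matrix ι κ ℝ) (i : ι) (j : κ) : X i j ^ 2 ≤ frobSq X := by
  refine le_trans ?_ (Finset.single_le_sum (f := fun i => ∑ j, X i j ^ 2)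
    (fun _ _ => Finset.sum_nonneg fun _ _ => sq_nonneg _) (Finset.mem_univ i))
  exact Finset.single_le_sum (f := fun j => X i j ^ 2) (fun _ _ => sq_nonneg _) (Finset.mem_univ j)

theorem frobSq_neg (X : Matrix ι κ ℝ) : frobSq (-X) = frobSq X := by
  simp [frobSq]

theorem frobSq_add (X Y : Matrix ι κ ℝ) :
    frobSq (X + Y) = frobSq X + frobSq Y + 2 * (X * Yᵀ).trace := by
  have h : (Y * Xᵀ).trace = (X * Yᵀ).trace := by
    rw [← trace_transpose, transpose_mul, transpose_transpose]
  simp only [frobSq_eq_trace, transpose_add, Matrix.add_mul, Matrix.mul_add, trace_add, h]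
  ring

theorem frobSq_add_le (X Y : Matrix ι κ ℝ) : frobSq (X + Y) ≤ 2 * frobSq X + 2 * frobSq Y := by
  simp only [frobSq, Finset.mul_sum, ← Finset.sum_add_distrib]
  refine Finset.sum_le_sum fun i _ => Finset.sum_le_sum fun j _ => ?_
  rw [Matrix.add_apply]
  nlinarith [sq_nonneg (X i j - Y i j)]

theorem frobSq_mul_le (X : Matrix ι κ ℝ) (Y : Matrix κ τ ℝ) :
    frobSq (X * Y) ≤ frobSq X * frobSq Y := by
  have h : ∀ i j, (X * Y) i j ^ 2 ≤ (∑ l, X i l ^ 2) * ∑ l, Y l j ^ 2 := fun i j => by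
    rw [Matrix.mul_apply]
    exact Finset.sum_mul_sq_le_sq_mul_sq _ _ _
  calc frobSq (X * Y) ≤ ∑ i, ∑ j, (∑ l, X i l ^ 2) * ∑ l, Y l j ^ 2 :=
        Finset.sum_le_sum fun i _ => Finset.sum_le_sum fun j _ => h i j
    _ = frobSq X * frobSq Y := by
        rw [← Finset.sum_mul_sum, frobSq]
        congr 1
        exact Finset.sum_comm

theorem frobSq_eq_sum_mulVec (X : Matrix ι κ ℝ) (Z : Matrix κ τ ℝ) :
    frobSq (X * Z) = ∑ j, (X *ᵥ (fun l => Z l j)) ⬝ᵥ (X *ᵥ (fun l => Z l j)) := by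
  rw [frobSq, Finset.sum_comm]
  refine Finset.sum_congr rfl fun j _ => Finset.sum_congr rfl fun i _ => ?_
  rw [sq]
  rfl

theorem frobSq_eq_sum_dotProduct (Z : Matrix κ τ ℝ) :
    frobSq Z = ∑ j, (fun l => Z l j) ⬝ᵥ (fun l => Z l j) := by
  rw [frobSq, Finset.sum_comm]
  exact Finset.sum_congr rfl fun j _ => Finset.sum_congr rfl fun i _ => sq _

theorem frobSq_vecMulVec (u : ι → ℝ) (v : κ → ℝ) :
    frobSq (vecMulVec u v) = (u ⬝ᵥ u) * (v ⬝ᵥ v) := by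
  simp only [frobSq, vecMulVec_apply, dotProduct, Finset.sum_mul_sum]
  exact Finset.sum_congr rfl fun i _ => Finset.sum_congr rfl fun j _ => by ring

end Frobenius

theorem isCompact_unit_dotProduct (ι : Type*) [Fintype ι] :
    IsCompact {y : ι → ℝ | y ⬝ᵥ y = 1} := by
  refine (isCompact_closedBall (0 : ι → ℝ) 1).of_isClosed_subset ?_ ?_
  · exact isClosed_eq (by fun_prop) continuous_const
  · intro y hy
    rw [mem_closedBall_zero_iff, pi_norm_le_iff_of_nonneg zero_le_one]
    intro i
    have h : y i * y i ≤ y ⬝ᵥ y :=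
      Finset.single_le_sum (f := fun i => y i * y i) (fun _ _ => mul_self_nonneg _)
        (Finset.mem_univ i)
    rw [Set.mem_ofPred_eq] at hy
    rw [hy] at h
    rw [Real.norm_eq_abs]
    exact abs_le_one_iff_mul_self_le_one.2 h

/-- An orthonormal basis, as the columns of a matrix, of the row space of `C`. -/
theorem exists_rowSpace_basis {n r : ℕ} (C : Matrix (Fin n) (Fin n) ℝ) (hr : C.rank = r) :
    ∃ V : Matrix (Fin n) (Fin r) ℝ, Vᵀ * V = 1 ∧ C * (V * Vᵀ) = C := by
  let e := WithLp.linearEquiv 2 ℝ (Fin n → ℝ)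
  let W : Submodule ℝ (EuclideanSpace ℝ (Fin n)) :=
    (Submodule.span ℝ (Set.range C.row)).map (e.symm : (Fin n → ℝ) →ₗ[ℝ] _)
  have hW : Module.finrank ℝ W = r := by
    rw [LinearEquiv.finrank_map_eq, ← rank_eq_finrank_span_row, hr]
  let b := (stdOrthonormalBasis ℝ W).reindex (finCongr hW)
  refine ⟨Matrix.of fun i j => (b j : EuclideanSpace ℝ (Fin n)) i, ?_, ?_⟩
  · ext i j
    have h := orthonormal_iff_ite.1 b.orthonormal i j
    rw [Submodule.coe_inner, PiLp.inner_apply] at h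
    simp only [Matrix.mul_apply, transpose_apply, of_apply, Matrix.one_apply]
    rw [← h]
    exact Finset.sum_congr rfl fun l _ => by simp [mul_comm]
  · ext i l
    have hi : e.symm (C i) ∈ W := Submodule.mem_map_of_mem (Submodule.subset_span ⟨i, rfl⟩)
    have h := congrArg (fun w : W => (w : EuclideanSpace ℝ (Fin n)) l) (b.sum_repr' ⟨_, hi⟩)
    simp only [Submodule.coe_sum, Submodule.coe_smul, Submodule.coe_inner, PiLp.inner_apply] at h
    rw [← Matrix.mul_assoc, Matrix.mul_apply]
    simp only [Matrix.mul_apply, transpose_apply, of_apply]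
    refine Eq.trans ?_ h
    simp [e, mul_comm]

/-! ### Projections onto orthonormal frames -/

section BestLowRank

variable {n k r : ℕ}

theorem frobSq_mul_transpose_of_orthonormal (A : Matrix (Fin n) (Fin n) ℝ)
    {V : Matrix (Fin n) (Fin r) ℝ} (hV : Vᵀ * V = 1) :
    frobSq (A * (V * Vᵀ)) = frobSq (A * V) := by
  rw [frobSq_eq_trace, frobSq_eq_trace]
  congr 1
  simp only [transpose_mul, transpose_transpose]
  calc A * (V * Vᵀ) * (V * Vᵀ * Aᵀ) = A * V * (Vᵀ * V) * (Vᵀ * Aᵀ) := by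
        simp only [Matrix.mul_assoc]
    _ = A * V * (Vᵀ * Aᵀ) := by rw [hV, Matrix.mul_one]

/-- Pythagoras for a matrix whose row space is contained in the column span of `V`. -/
theorem frobSq_sub_eq_of_orthonormal (A : Matrix (Fin n) (Fin n) ℝ) {C : Matrix (Fin n) (Fin n) ℝ}
    {V : Matrix (Fin n) (Fin r) ℝ} (hV : Vᵀ * V = 1) (hC : C * (V * Vᵀ) = C) :
    frobSq (A - C) = frobSq A - frobSq (A * V) + frobSq (A * (V * Vᵀ) - C) := by
  have key : ∀ D : Matrix (Fin n) (Fin n) ℝ, D * (V * Vᵀ) = D →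
      ((A - A * (V * Vᵀ)) * Dᵀ).trace = 0 := fun D hD => by
    have : (A - A * (V * Vᵀ)) * Dᵀ = 0 := by
      rw [← hD]
      simp only [transpose_mul, transpose_transpose, Matrix.sub_mul]
      have h : A * (V * Vᵀ) * (V * Vᵀ * Dᵀ) = A * (V * (Vᵀ * V) * Vᵀ * Dᵀ) := by
        simp only [Matrix.mul_assoc]
      rw [h, hV, Matrix.mul_one, sub_self]
    rw [this, trace_zero]
  have hP : A * (V * Vᵀ) * (V * Vᵀ) = A * (V * Vᵀ) := by
    calc A * (V * Vᵀ) * (V * Vᵀ) = A * (V * (Vᵀ * V) * Vᵀ) := by simp only [Matrix.mul_assoc]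
      _ = _ := by rw [hV, Matrix.mul_one]
  have h1 : frobSq A = frobSq (A - A * (V * Vᵀ)) + frobSq (A * V) := by
    conv_lhs => rw [← sub_add_cancel A (A * (V * Vᵀ))]
    rw [frobSq_add, key _ hP, frobSq_mul_transpose_of_orthonormal A hV]
    ring
  have h2 : frobSq (A - C) = frobSq (A - A * (V * Vᵀ)) + frobSq (A * (V * Vᵀ) - C) := by
    conv_lhs => rw [← sub_add_sub_cancel A (A * (V * Vᵀ)) C]
    rw [frobSq_add, key _ (by rw [Matrix.sub_mul, hP, hC])]
    ring
  rw [h1, h2]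
  ring

/-- Replacing the direction `V a` of the orthonormal frame `V` by `ω`. -/
theorem orthonormal_rotate {V : Matrix (Fin n) (Fin k) ℝ} (hV : Vᵀ * V = 1) {a : Fin k → ℝ}
    (ha : a ⬝ᵥ a = 1) {ω : Fin n → ℝ} (hω : ω ⬝ᵥ ω = 1) {c : ℝ} (hc : Vᵀ *ᵥ ω = c • a) :
    (V + vecMulVec (ω - V *ᵥ a) a)ᵀ * (V + vecMulVec (ω - V *ᵥ a) a) = 1 := by
  have hVa : Vᵀ *ᵥ (V *ᵥ a) = a := by rw [mulVec_mulVec, hV, one_mulVec]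
  -- By `hc`, ω is orthogonal to the frame directions other than V a. The Gram matrix of the new
  -- frame is therefore 1 + 2(c - 1) a aᵀ + (2 - 2c) a aᵀ = 1.
  have h1 : Vᵀ *ᵥ (ω - V *ᵥ a) = (c - 1) • a := by
    rw [mulVec_sub, hc, hVa, sub_smul, one_smul]
  have h2 : (V *ᵥ a) ⬝ᵥ ω = c := by
    rw [dotProduct_comm, ← vecMul_transpose, dotProduct_comm, ← dotProduct_mulVec, hc,
      dotProduct_smul, ha, smul_eq_mul, mul_one]
  have h3 : (V *ᵥ a) ⬝ᵥ (V *ᵥ a) = 1 := by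
    conv_lhs => lhs; rw [← vecMul_transpose]
    rw [← dotProduct_mulVec, hVa, ha]
  have h4 : (ω - V *ᵥ a) ⬝ᵥ (ω - V *ᵥ a) = 2 - 2 * c := by
    rw [sub_dotProduct, dotProduct_sub, dotProduct_sub, hω, h2, h3, dotProduct_comm, h2]
    ring
  have h5 : vecMul (ω - V *ᵥ a) V = (c - 1) • a := by
    rw [← h1, mulVec_transpose]
  rw [transpose_add, transpose_vecMulVec, Matrix.add_mul, Matrix.mul_add, Matrix.mul_add, hV,
    mul_vecMulVec, h1, vecMulVec_mul, h5, vecMulVec_mul_vecMulVec, h4]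
  ext i j
  simp only [Matrix.add_apply, vecMulVec_apply, Pi.smul_apply, smul_eq_mul]
  ring

/-- The rotated frame agrees with V on the orthogonal complement of a and sends a to ω, so only the
contribution of a changes. -/
theorem frobSq_mul_rotate (A : Matrix (Fin n) (Fin n) ℝ) (V : Matrix (Fin n) (Fin k) ℝ)
    {a : Fin k → ℝ} (ha : a ⬝ᵥ a = 1) (ω : Fin n → ℝ) :
    frobSq (A * (V + vecMulVec (ω - V *ᵥ a) a)) =
      frobSq (A * V) + (A *ᵥ ω) ⬝ᵥ (A *ᵥ ω) - (A *ᵥ V *ᵥ a) ⬝ᵥ (A *ᵥ V *ᵥ a) := by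
  rw [Matrix.mul_add, mul_vecMulVec, frobSq_add, frobSq_vecMulVec, ha, transpose_vecMulVec,
    mul_vecMulVec, trace_vecMulVec, ← mulVec_mulVec, mulVec_sub]
  simp only [dotProduct_sub, sub_dotProduct]
  rw [dotProduct_comm (A *ᵥ ω) (A *ᵥ V *ᵥ a)]
  ring

theorem mul_frobSq_le_of_forall {ι κ τ : Type*} [Fintype ι] [Fintype κ] [Fintype τ]
    (X : Matrix ι κ ℝ) {a : ℝ}
    (h : ∀ y : κ → ℝ, a * (y ⬝ᵥ y) ≤ (X *ᵥ y) ⬝ᵥ (X *ᵥ y)) (Z : Matrix κ τ ℝ) :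
    a * frobSq Z ≤ frobSq (X * Z) := by
  rw [frobSq_eq_sum_mulVec, frobSq_eq_sum_dotProduct, Finset.mul_sum]
  exact Finset.sum_le_sum fun j _ => h _

/-- Trace gap between two orthonormal frames, for a frame `V` spanning a spectral subspace of
`Aᵀ A` separated from its complement. -/
theorem frobSq_mul_frame_gap (A : Matrix (Fin n) (Fin n) ℝ) {V : Matrix (Fin n) (Fin k) ℝ}
    (hV : Vᵀ * V = 1) {a b : ℝ} (hb : 0 ≤ b)
    (hcross : ∀ z w, Vᵀ *ᵥ w = 0 → (A *ᵥ V *ᵥ z) ⬝ᵥ (A *ᵥ w) = 0)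
    (hlow : ∀ z, a * (z ⬝ᵥ z) ≤ (A *ᵥ V *ᵥ z) ⬝ᵥ (A *ᵥ V *ᵥ z))
    (hup : ∀ w, Vᵀ *ᵥ w = 0 → (A *ᵥ w) ⬝ᵥ (A *ᵥ w) ≤ b * (w ⬝ᵥ w))
    {V' : Matrix (Fin n) (Fin r) ℝ} (hV' : V'ᵀ * V' = 1) (hr : r ≤ k) :
    0 ≤ (k : ℝ) - frobSq (Vᵀ * V') ∧
    (a - b) * (k - frobSq (Vᵀ * V')) ≤ frobSq (A * V) - frobSq (A * V') ∧
    frobSq (V' * V'ᵀ - V * Vᵀ) ≤ 2 * (k - frobSq (Vᵀ * V')) := by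
  set W := Vᵀ * V' with hW
  have hWt : V'ᵀ * V = Wᵀ := by rw [hW, transpose_mul, transpose_transpose]
  -- Y is the part of V orthogonal to the span of V', and Z the part of V' orthogonal to the span of
  -- V. Their squared norms are k - ‖W‖² and r - ‖W‖².
  set Y := V - V' * Wᵀ with hY
  set Z := V' - V * W with hZ
  have hYY : Yᵀ * Y = 1 - W * Wᵀ := by
    rw [hY, transpose_sub, transpose_mul, transpose_transpose]
    have h1 : (Vᵀ - W * V'ᵀ) * (V - V' * Wᵀ) =
        Vᵀ * V - (Vᵀ * V') * Wᵀ - W * (V'ᵀ * V) + W * (V'ᵀ * V') * Wᵀ := by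
      simp only [Matrix.sub_mul, Matrix.mul_sub, Matrix.mul_assoc]
      abel
    rw [h1, hV, ← hW, hWt, hV', Matrix.mul_one]
    abel
  have hZZ : Zᵀ * Z = 1 - Wᵀ * W := by
    rw [hZ, transpose_sub, transpose_mul]
    have h1 : (V'ᵀ - Wᵀ * Vᵀ) * (V' - V * W) =
        V'ᵀ * V' - (V'ᵀ * V) * W - Wᵀ * (Vᵀ * V') + Wᵀ * (Vᵀ * V) * W := by
      simp only [Matrix.sub_mul, Matrix.mul_sub, Matrix.mul_assoc]
      abel
    rw [h1, hV, ← hW, hWt, hV', Matrix.mul_one]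
    abel
  have hfY : frobSq Y = k - frobSq W := by
    rw [frobSq_eq_trace', hYY, trace_sub, trace_one, Fintype.card_fin, frobSq_eq_trace W]
  have hfZ : frobSq Z = r - frobSq W := by
    rw [frobSq_eq_trace', hZZ, trace_sub, trace_one, Fintype.card_fin, frobSq_eq_trace' W]
  have hVZ : Vᵀ * Z = 0 := by
    rw [hZ, Matrix.mul_sub, ← Matrix.mul_assoc, hV, Matrix.one_mul, ← hW, sub_self]
  have hVZcol : ∀ j, Vᵀ *ᵥ (fun l => Z l j) = 0 := fun j => by
    ext i
    exact congrFun (congrFun hVZ i) j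
  have hsplit : frobSq (A * V') = frobSq (A * V * W) + frobSq (A * Z) := by
    have h1 : A * V' = A * V * W + A * Z := by
      rw [hZ, Matrix.mul_sub, Matrix.mul_assoc]; abel
    have h2 : (A * V)ᵀ * (A * Z) = 0 := by
      ext i j
      have := hcross (Pi.single i 1) _ (hVZcol j)
      rw [mulVec_mulVec, mulVec_single_one] at this
      exact this
    rw [h1, frobSq_add, trace_mul_comm, ← trace_transpose, transpose_mul, transpose_transpose,
      transpose_mul, Matrix.mul_assoc Wᵀ, h2, Matrix.mul_zero, trace_zero]
    ring
  have hlow' : a * frobSq Y ≤ frobSq (A * V * Yᵀ) := by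
    rw [← frobSq_transpose Y]
    refine mul_frobSq_le_of_forall _ (fun y => ?_) _
    rw [← mulVec_mulVec]
    exact hlow y
  have hup' : frobSq (A * Z) ≤ b * frobSq Z := by
    rw [frobSq_eq_sum_mulVec, frobSq_eq_sum_dotProduct, Finset.mul_sum]
    exact Finset.sum_le_sum fun j _ => hup _ (hVZcol j)
  have hdecomp : frobSq (A * V * Yᵀ) = frobSq (A * V) - frobSq (A * V * W) := by
    rw [frobSq_eq_trace, frobSq_eq_trace, frobSq_eq_trace, ← trace_sub]
    congr 1
    have h1 : A * V * Yᵀ * (A * V * Yᵀ)ᵀ = A * V * (Yᵀ * Y) * (A * V)ᵀ := by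
      simp only [transpose_mul, transpose_transpose, Matrix.mul_assoc]
    rw [h1, hYY, Matrix.mul_sub, Matrix.sub_mul, Matrix.mul_one]
    congr 1
    simp only [transpose_mul, Matrix.mul_assoc]
  have hrk : (r : ℝ) ≤ k := by exact_mod_cast hr
  -- ‖AV‖² - ‖AV'‖² = ‖AVYᵀ‖² - ‖AZ‖² ≥ a(k - ‖W‖²) - b(r - ‖W‖²), where r ≤ k and b ≥ 0. The
  -- squared distance of the two projections is k + r - 2‖W‖².
  refine ⟨hfY ▸ frobSq_nonneg Y, ?_, ?_⟩
  · rw [hfY] at hlow'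
    rw [hfZ] at hup'
    nlinarith [mul_le_mul_of_nonneg_left hrk hb]
  · have hproj : ∀ {s : ℕ} {U : Matrix (Fin n) (Fin s) ℝ}, Uᵀ * U = 1 → frobSq (U * Uᵀ) = s := by
      intro s U hU
      rw [frobSq_eq_trace, transpose_mul, transpose_transpose]
      have : U * Uᵀ * (U * Uᵀ) = U * (Uᵀ * U) * Uᵀ := by simp only [Matrix.mul_assoc]
      rw [this, hU, Matrix.mul_one, trace_mul_comm, hU, trace_one, Fintype.card_fin]
    have hx : (V' * V'ᵀ * (-(V * Vᵀ))ᵀ).trace = - frobSq W := by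
      rw [transpose_neg, Matrix.mul_neg, trace_neg, frobSq_eq_trace, transpose_mul,
        transpose_transpose, ← Matrix.mul_assoc, trace_mul_comm, ← hWt]
      simp only [hW, Matrix.mul_assoc]
    rw [sub_eq_add_neg, frobSq_add, frobSq_neg, hproj hV, hproj hV', hx]
    linarith

end BestLowRank

/-! ### Quadratic growth at a unique best low-rank approximation -/

section Growth

variable {n k r : ℕ}

/-- C factors through C V, so C V has rank k; having k columns, it is injective. -/
theorem mulVec_injective_of_rank_mul {C : Matrix (Fin n) (Fin n) ℝ} {V : Matrix (Fin n) (Fin k) ℝ}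
    (hC : C.rank = k) (hCV : C * (V * Vᵀ) = C) {z : Fin k → ℝ} (hz : C *ᵥ V *ᵥ z = 0) : z = 0 := by
  have h1 : k ≤ (C * V).rank := by
    conv_lhs => rw [← hC, ← hCV, ← Matrix.mul_assoc]
    exact rank_mul_le_left _ _
  have h2 := LinearMap.finrank_range_add_finrank_ker (C * V).mulVecLin
  rw [Module.finrank_fintype_fun_eq_card, Fintype.card_fin] at h2
  have h3 : (C * V).rank = Module.finrank ℝ (C * V).mulVecLin.range := rfl
  have h4 : Module.finrank ℝ (C * V).mulVecLin.ker = 0 := by omega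
  have h5 : z ∈ (C * V).mulVecLin.ker := by
    rw [LinearMap.mem_ker, mulVecLin_apply, ← mulVec_mulVec, hz]
  rw [Submodule.finrank_eq_zero.1 h4] at h5
  exact h5

theorem exists_unit_smul {ι : Type*} [Fintype ι] {y : ι → ℝ} (hy : y ≠ 0) :
    ∃ (t : ℝ) (u : ι → ℝ), u ⬝ᵥ u = 1 ∧ y = t • u := by
  have h0 : 0 < y ⬝ᵥ y := by
    rcases (Finset.sum_nonneg fun i _ => mul_self_nonneg (y i) : 0 ≤ y ⬝ᵥ y).lt_or_eq with h | h
    · exact h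
    · exact absurd (dotProduct_self_eq_zero.1 h.symm) hy
  have hs := Real.sqrt_pos.2 h0
  refine ⟨√(y ⬝ᵥ y), (√(y ⬝ᵥ y))⁻¹ • y, ?_, ?_⟩
  · rw [smul_dotProduct, dotProduct_smul, smul_eq_mul, smul_eq_mul, ← mul_assoc, ← mul_inv,
      Real.mul_self_sqrt h0.le, inv_mul_cancel₀ h0.ne']
  · rw [smul_smul, mul_inv_cancel₀ hs.ne', one_smul]

/-- If `C` is the unique best approximation of `A` of rank at most `k`, and has rank `k`, then the
approximation error grows quadratically in the distance to `C`. -/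
theorem frobSq_sub_growth (A C : Matrix (Fin n) (Fin n) ℝ) (hk : 0 < k) (hC : C.rank = k)
    (hmin : ∀ C' : Matrix (Fin n) (Fin n) ℝ, C'.rank ≤ k → C' ≠ C →
      frobSq (A - C) < frobSq (A - C')) :
    ∃ c : ℝ, 0 < c ∧ ∀ C' : Matrix (Fin n) (Fin n) ℝ, C'.rank ≤ k →
      frobSq (A - C) + c * frobSq (C' - C) ≤ frobSq (A - C') := by
  obtain ⟨V, hV, hCV⟩ := exists_rowSpace_basis C hC
  have hrank : ∀ {r : ℕ} (V' : Matrix (Fin n) (Fin r) ℝ), r ≤ k → (A * (V' * V'ᵀ)).rank ≤ k :=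
    fun {r} V' hr => by
      rw [← Matrix.mul_assoc]
      exact (rank_mul_le_left _ _).trans ((rank_le_width _).trans hr)
  -- Best approximation thus amounts to maximising ‖A V'‖² over orthonormal frames V'.
  have hpy : ∀ V' : Matrix (Fin n) (Fin k) ℝ, V'ᵀ * V' = 1 →
      frobSq (A - A * (V' * V'ᵀ)) = frobSq A - frobSq (A * V') := fun V' hV' => by
    have h : A * (V' * V'ᵀ) * (V' * V'ᵀ) = A * (V' * V'ᵀ) := by
      calc A * (V' * V'ᵀ) * (V' * V'ᵀ) = A * (V' * (V'ᵀ * V') * V'ᵀ) := by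
            simp only [Matrix.mul_assoc]
        _ = _ := by rw [hV', Matrix.mul_one]
    rw [frobSq_sub_eq_of_orthonormal A hV' h, sub_self]
    simp [frobSq]
  -- Otherwise projecting A onto the row space of C would be at least as good as C, against
  -- uniqueness.
  have hCA : A * (V * Vᵀ) = C := by
    by_contra hne
    have h1 := hmin _ (hrank V le_rfl) hne
    rw [hpy V hV, frobSq_sub_eq_of_orthonormal A hV hCV] at h1
    linarith [frobSq_nonneg (A * (V * Vᵀ) - C)]
  have hACf : frobSq (A - C) = frobSq A - frobSq (A * V) := by rw [← hpy V hV, hCA]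
  have hCVz : ∀ z, C *ᵥ V *ᵥ z = A *ᵥ V *ᵥ z := fun z => by
    rw [← hCA]
    simp only [mulVec_mulVec]
    congr 1
    calc A * (V * Vᵀ) * V = A * (V * (Vᵀ * V)) := by simp only [Matrix.mul_assoc]
      _ = _ := by rw [hV, Matrix.mul_one]
  -- Optimality of V is tested only against frames with one direction rotated. Uniqueness makes the
  -- inequality strict when the new direction is orthogonal to the span of V.
  have hrot : ∀ a : Fin k → ℝ, a ⬝ᵥ a = 1 → ∀ ω : Fin n → ℝ, ω ⬝ᵥ ω = 1 → ∀ c : ℝ,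
      Vᵀ *ᵥ ω = c • a → (A *ᵥ ω) ⬝ᵥ (A *ᵥ ω) ≤ (A *ᵥ V *ᵥ a) ⬝ᵥ (A *ᵥ V *ᵥ a) ∧
        (c = 0 → (A *ᵥ ω) ⬝ᵥ (A *ᵥ ω) < (A *ᵥ V *ᵥ a) ⬝ᵥ (A *ᵥ V *ᵥ a)) := by
    intro a ha ω hω c hc
    have hV' := orthonormal_rotate hV ha hω hc
    have hf := frobSq_mul_rotate A V ha ω
    set V' := V + vecMulVec (ω - V *ᵥ a) a with hV'def
    by_cases heq : A * (V' * V'ᵀ) = C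
    · have h1 := hpy V' hV'
      rw [heq, hACf, hf] at h1
      refine ⟨by linarith, fun hc0 => ?_⟩
      -- If the rotated frame still produced C, then C would annihilate V a, which the new frame is
      -- orthogonal to, and C would have rank below k.
      exfalso
      have h2 : V'ᵀ *ᵥ (V *ᵥ a) = 0 := by
        have hVa : Vᵀ *ᵥ (V *ᵥ a) = a := by rw [mulVec_mulVec, hV, one_mulVec]
        have h3 : (V *ᵥ a) ⬝ᵥ ω = 0 := by
          rw [dotProduct_comm, ← vecMul_transpose, dotProduct_comm, ← dotProduct_mulVec, hc, hc0,
            zero_smul, dotProduct_zero]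
        have h4 : (V *ᵥ a) ⬝ᵥ (V *ᵥ a) = 1 := by
          conv_lhs => lhs; rw [← vecMul_transpose]
          rw [← dotProduct_mulVec, hVa, ha]
        rw [hV'def, transpose_add, transpose_vecMulVec, add_mulVec, hVa, vecMulVec_mulVec,
          sub_dotProduct, h4, dotProduct_comm, h3]
        simp
      have h5 : C *ᵥ V *ᵥ a = 0 := by
        rw [← heq, ← Matrix.mul_assoc, ← mulVec_mulVec, h2, mulVec_zero]
      have h6 := mulVec_injective_of_rank_mul hC hCV h5
      rw [h6, dotProduct_zero] at ha
      exact zero_ne_one ha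
    · have h1 := hmin _ (hrank V' le_rfl) heq
      rw [hpy V' hV', hACf, hf] at h1
      exact ⟨by linarith, fun _ => by linarith⟩
  have hcross1 : ∀ z, z ⬝ᵥ z = 1 → ∀ w, Vᵀ *ᵥ w = 0 → (A *ᵥ V *ᵥ z) ⬝ᵥ (A *ᵥ w) = 0 := by
    intro z hz w hw
    have hVz : Vᵀ *ᵥ (V *ᵥ z) = z := by rw [mulVec_mulVec, hV, one_mulVec]
    have h4 : (V *ᵥ z) ⬝ᵥ (V *ᵥ z) = 1 := by
      conv_lhs => lhs; rw [← vecMul_transpose]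
      rw [← dotProduct_mulVec, hVz, hz]
    have h3 : (V *ᵥ z) ⬝ᵥ w = 0 := by
      rw [dotProduct_comm, ← vecMul_transpose, dotProduct_comm, ← dotProduct_mulVec, hw,
        dotProduct_zero]
    -- Rotate V z towards w: the normalised vector V z + t w does not beat V z, for any t. The
    -- linear term in t must then vanish, which makes the span of V invariant under AᵀA.
    have hq : ∀ t : ℝ, 2 * t * ((A *ᵥ V *ᵥ z) ⬝ᵥ (A *ᵥ w)) + t ^ 2 * ((A *ᵥ w) ⬝ᵥ (A *ᵥ w)) ≤
        t ^ 2 * ((w ⬝ᵥ w) * ((A *ᵥ V *ᵥ z) ⬝ᵥ (A *ᵥ V *ᵥ z))) := by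
      intro t
      have hww : 0 ≤ w ⬝ᵥ w := Finset.sum_nonneg fun i _ => mul_self_nonneg (w i)
      have hpos : 0 < 1 + t ^ 2 * (w ⬝ᵥ w) := by positivity
      set s := √(1 + t ^ 2 * (w ⬝ᵥ w)) with hs
      have hspos : 0 < s := Real.sqrt_pos.2 hpos
      have hss : s * s = 1 + t ^ 2 * (w ⬝ᵥ w) := Real.mul_self_sqrt hpos.le
      have h5 := (hrot z hz (s⁻¹ • (V *ᵥ z + t • w)) ?_ s⁻¹ ?_).1
      · rw [mulVec_smul, smul_dotProduct, dotProduct_smul, mulVec_add, mulVec_smul, add_dotProduct,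
          dotProduct_add, dotProduct_add, smul_dotProduct, dotProduct_smul, smul_dotProduct,
          dotProduct_smul, dotProduct_comm (A *ᵥ w)] at h5
        simp only [smul_eq_mul] at h5
        rw [← mul_assoc, ← mul_inv, inv_mul_le_iff₀ (by positivity), hss] at h5
        linarith
      · rw [smul_dotProduct, dotProduct_smul, add_dotProduct,
          dotProduct_add, dotProduct_add, smul_dotProduct, dotProduct_smul, smul_dotProduct,
          dotProduct_smul, dotProduct_comm w, h3, h4]
        simp only [smul_eq_mul]
        rw [← mul_assoc, ← mul_inv, hss, inv_mul_eq_one₀ hpos.ne']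
        ring
      · rw [mulVec_smul, mulVec_add, mulVec_smul, hVz, hw, smul_zero, add_zero]
    set x := (A *ᵥ V *ᵥ z) ⬝ᵥ (A *ᵥ w)
    set h := (A *ᵥ w) ⬝ᵥ (A *ᵥ w)
    set g := (w ⬝ᵥ w) * ((A *ᵥ V *ᵥ z) ⬝ᵥ (A *ᵥ V *ᵥ z))
    -- With t = x / (|g - h| + 1) the linear term outweighs the quadratic one unless x = 0.
    have hM : 0 < |g - h| + 1 := by positivity
    have h6 := hq (x / (|g - h| + 1))
    have h7 : 2 * (x / (|g - h| + 1)) * x + (x / (|g - h| + 1)) ^ 2 * h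
        - (x / (|g - h| + 1)) ^ 2 * g =
        x ^ 2 * (2 * (|g - h| + 1) - (g - h)) / (|g - h| + 1) ^ 2 := by
      field_simp
      ring
    have h8 : x ^ 2 * (2 * (|g - h| + 1) - (g - h)) / (|g - h| + 1) ^ 2 ≤ 0 := by linarith
    rw [div_le_iff₀ (by positivity), zero_mul] at h8
    have h9 := le_abs_self (g - h)
    by_contra hx
    have h10 : 0 < x ^ 2 := by positivity
    have h11 : 0 < 2 * (|g - h| + 1) - (g - h) := by linarith
    linarith [mul_pos h10 h11]
  have hcross : ∀ z w, Vᵀ *ᵥ w = 0 → (A *ᵥ V *ᵥ z) ⬝ᵥ (A *ᵥ w) = 0 := by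
    intro z w hw
    by_cases hz : z = 0
    · rw [hz, mulVec_zero, mulVec_zero, zero_dotProduct]
    · obtain ⟨t, u, hu, rfl⟩ := exists_unit_smul hz
      rw [mulVec_smul, mulVec_smul, smul_dotProduct, hcross1 u hu w hw, smul_zero]
  obtain ⟨z₀, hz₀, hz₀min⟩ := (isCompact_unit_dotProduct (Fin k)).exists_isMinOn
    ⟨Pi.single ⟨0, hk⟩ 1, by simp⟩
    (f := fun z => (A *ᵥ V *ᵥ z) ⬝ᵥ (A *ᵥ V *ᵥ z)) (by fun_prop)
  set a := (A *ᵥ V *ᵥ z₀) ⬝ᵥ (A *ᵥ V *ᵥ z₀) with ha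
  have hapos : 0 < a := by
    rcases (Finset.sum_nonneg fun i _ => mul_self_nonneg _ : 0 ≤ a).lt_or_eq with h | h
    · exact h
    · have h1 := dotProduct_self_eq_zero.1
        (h.symm : (A *ᵥ V *ᵥ z₀) ⬝ᵥ (A *ᵥ V *ᵥ z₀) = 0)
      rw [← hCVz] at h1
      have h2 := mulVec_injective_of_rank_mul hC hCV h1
      have h3 : z₀ ⬝ᵥ z₀ = 1 := hz₀
      rw [h2, dotProduct_zero] at h3
      exact absurd h3 zero_ne_one
  have hlow : ∀ z, a * (z ⬝ᵥ z) ≤ (A *ᵥ V *ᵥ z) ⬝ᵥ (A *ᵥ V *ᵥ z) := by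
    intro z
    by_cases hz : z = 0
    · simp [hz]
    · obtain ⟨t, u, hu, rfl⟩ := exists_unit_smul hz
      have h1 : a ≤ (A *ᵥ V *ᵥ u) ⬝ᵥ (A *ᵥ V *ᵥ u) := hz₀min hu
      rw [mulVec_smul, mulVec_smul]
      simp only [smul_dotProduct, dotProduct_smul, smul_eq_mul, hu]
      nlinarith [mul_self_nonneg t]
  -- Here a is the smallest value of ‖A·‖² on the unit sphere of the span of V, and b the largest on
  -- that of its complement. Both are attained, so the strict case of `hrot` gives b < a; if the
  -- complement is trivial, b = 0 < a.
  obtain ⟨b, hb, hba, hup1⟩ : ∃ b : ℝ, 0 ≤ b ∧ b < a ∧ ∀ w, w ⬝ᵥ w = 1 → Vᵀ *ᵥ w = 0 →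
      (A *ᵥ w) ⬝ᵥ (A *ᵥ w) ≤ b := by
    have hcomp : IsCompact {w : Fin n → ℝ | w ⬝ᵥ w = 1 ∧ Vᵀ *ᵥ w = 0} :=
      (isCompact_unit_dotProduct (Fin n)).inter_right
        (isClosed_eq (by fun_prop) continuous_const : IsClosed {w : Fin n → ℝ | Vᵀ *ᵥ w = 0})
    rcases Set.eq_empty_or_nonempty {w : Fin n → ℝ | w ⬝ᵥ w = 1 ∧ Vᵀ *ᵥ w = 0} with he | hne
    · refine ⟨0, le_rfl, hapos, fun w hw hw0 => ?_⟩
      have : w ∈ {w : Fin n → ℝ | w ⬝ᵥ w = 1 ∧ Vᵀ *ᵥ w = 0} := ⟨hw, hw0⟩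
      rw [he] at this
      exact this.elim
    · obtain ⟨w₀, hw₀, hmax⟩ := hcomp.exists_isMaxOn hne
        (f := fun w => (A *ᵥ w) ⬝ᵥ (A *ᵥ w)) (by fun_prop)
      refine ⟨(A *ᵥ w₀) ⬝ᵥ (A *ᵥ w₀), Finset.sum_nonneg fun i _ => mul_self_nonneg _, ?_, ?_⟩
      · exact (hrot z₀ hz₀ w₀ hw₀.1 0 (by rw [hw₀.2, zero_smul])).2 rfl
      · exact fun w hw hw0 => hmax ⟨hw, hw0⟩
  have hup : ∀ w, Vᵀ *ᵥ w = 0 → (A *ᵥ w) ⬝ᵥ (A *ᵥ w) ≤ b * (w ⬝ᵥ w) := by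
    intro w hw
    by_cases hz : w = 0
    · simp [hz]
    · obtain ⟨t, u, hu, rfl⟩ := exists_unit_smul hz
      by_cases ht : t = 0
      · simp [ht]
      · have h1 := hup1 u hu (by
          rw [mulVec_smul] at hw
          exact (smul_eq_zero.1 hw).resolve_left ht)
        rw [mulVec_smul]
        simp only [smul_dotProduct, dotProduct_smul, smul_eq_mul, hu]
        nlinarith [mul_self_nonneg t]
  have hα := frobSq_nonneg A
  -- Write C' - C as the error of C' inside its own row space plus A times the difference of the
  -- projections. The first part needs 2c ≤ 1, the second 4c‖A‖² ≤ a - b.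
  refine ⟨min (1 / 2) ((a - b) / (4 * (frobSq A + 1))), lt_min (by norm_num)
    (div_pos (by linarith) (by linarith)), fun C' hC' => ?_⟩
  obtain ⟨V', hV', hCV'⟩ := exists_rowSpace_basis C' rfl
  obtain ⟨hκ, hgap, hdist⟩ := frobSq_mul_frame_gap A hV hb hcross hlow hup hV' hC'
  have h1 := frobSq_sub_eq_of_orthonormal A hV' hCV'
  have h2 : frobSq (C' - C) ≤ 2 * frobSq (A * (V' * V'ᵀ) - C') +
      2 * (frobSq A * (2 * (k - frobSq (Vᵀ * V')))) := by
    have h3 : C' - C = -(A * (V' * V'ᵀ) - C') + A * (V' * V'ᵀ - V * Vᵀ) := by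
      rw [Matrix.mul_sub, hCA]; abel
    rw [h3]
    refine (frobSq_add_le _ _).trans ?_
    rw [frobSq_neg]
    have h4 := frobSq_mul_le A (V' * V'ᵀ - V * Vᵀ)
    have h5 := mul_le_mul_of_nonneg_left hdist hα
    linarith
  set κ := (k : ℝ) - frobSq (Vᵀ * V')
  set X := frobSq (A * (V' * V'ᵀ) - C') with hX
  have hX0 : 0 ≤ X := frobSq_nonneg _
  set c := min (1 / 2) ((a - b) / (4 * (frobSq A + 1)))
  have hc0 : 0 ≤ c := le_min (by norm_num) (div_nonneg (by linarith) (by linarith))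
  have hc1 : c ≤ 1 / 2 := min_le_left _ _
  have hc2 : c * (4 * (frobSq A + 1)) ≤ a - b := by
    rw [← le_div_iff₀ (by linarith)]
    exact min_le_right _ _
  have h6 := mul_le_mul_of_nonneg_left h2 hc0
  have h7 := mul_le_mul_of_nonneg_right hc2 hκ
  have h8 := mul_le_mul_of_nonneg_right hc1 hX0
  have h9 : 0 ≤ c * κ := mul_nonneg hc0 hκ
  rw [hACf, h1]
  nlinarith

end Growth

/-! ### The identified target and growth of the limiting criterion -/

section Target

variable {n k : ℕ}

/-- The distance of two families of matrices, in the Euclidean norm of the entries. -/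
def familyDist (B B' : Fin n → Matrix (Fin n) (Fin n) ℝ) : ℝ :=
  √(∑ x, frobSq (B x - B' x))

/-- The low-rank criterion as a function of the products. -/
def productLoss (q : Fin n → Fin n → Fin n → ℝ) (B : Fin n → Matrix (Fin n) (Fin n) ℝ) : ℝ :=
  ∑ x, frobSq (P3x1 q x - B x * P21 q)

theorem criterion_eq_productLoss (q : Fin n → Fin n → Fin n → ℝ) (θ : Factors n k) :
    criterion q θ = productLoss q θ.prod := rfl

theorem familyDist_nonneg (B B' : Fin n → Matrix (Fin n) (Fin n) ℝ) : 0 ≤ familyDist B B' :=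
  Real.sqrt_nonneg _

theorem familyDist_sq (B B' : Fin n → Matrix (Fin n) (Fin n) ℝ) :
    familyDist B B' ^ 2 = ∑ x, frobSq (B x - B' x) :=
  Real.sq_sqrt (Finset.sum_nonneg fun _ _ => frobSq_nonneg _)

theorem abs_sub_le_familyDist (B B' : Fin n → Matrix (Fin n) (Fin n) ℝ) (x i j : Fin n) :
    |B x i j - B' x i j| ≤ familyDist B B' := by
  refine Real.abs_le_sqrt ?_
  exact (sq_le_frobSq (B x - B' x) i j).trans
    (Finset.single_le_sum (f := fun x => frobSq (B x - B' x)) (fun _ _ => frobSq_nonneg _)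
      (Finset.mem_univ x))

theorem familyDist_eq_zero {B B' : Fin n → Matrix (Fin n) (Fin n) ℝ} (h : familyDist B B' = 0) :
    B = B' := by
  ext x i j
  have := abs_sub_le_familyDist B B' x i j
  rw [h] at this
  exact sub_eq_zero.1 (abs_eq_zero.1 (le_antisymm this (abs_nonneg _)))

theorem familyDist_le_of_abs_le {B B' : Fin n → Matrix (Fin n) (Fin n) ℝ} {e : ℝ} (he : 0 ≤ e)
    (h : ∀ x i j, |B x i j - B' x i j| ≤ e) : familyDist B B' ≤ n ^ 2 * e := by
  refine Real.sqrt_le_iff.2 ⟨by positivity, ?_⟩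
  have h1 : ∑ x, frobSq (B x - B' x) ≤ ∑ _x : Fin n, ∑ _i : Fin n, ∑ _j : Fin n, e ^ 2 :=
    Finset.sum_le_sum fun x _ => Finset.sum_le_sum fun i _ => Finset.sum_le_sum fun j _ => by
      rw [Matrix.sub_apply]
      exact sq_le_sq' (abs_le.1 (h x i j)).1 (abs_le.1 (h x i j)).2
  simp only [Finset.sum_const, Finset.card_univ, Fintype.card_fin, nsmul_eq_mul] at h1
  refine h1.trans ?_
  rcases Nat.eq_zero_or_pos n with rfl | hn
  · simp
  · have : (1 : ℝ) ≤ n := by exact_mod_cast hn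
    nlinarith [mul_le_mul_of_nonneg_right this (by positivity : 0 ≤ (n : ℝ) ^ 3 * e ^ 2)]

/-- A matrix of rank at most `k` is a product of matrices with `k` columns. -/
theorem exists_factorization {C : Matrix (Fin n) (Fin n) ℝ} (hC : C.rank ≤ k) :
    ∃ R S : Matrix (Fin n) (Fin k) ℝ, C = R * Sᵀ := by
  obtain ⟨V, -, hCV⟩ := exists_rowSpace_basis C rfl
  -- J pads the rank C columns with zero columns up to k.
  let J : Matrix (Fin C.rank) (Fin k) ℝ :=
    Matrix.of fun i j => if j = Fin.castLE hC i then 1 else 0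
  have hJ : J * Jᵀ = 1 := by
    ext i j
    simp only [J, Matrix.mul_apply, transpose_apply, of_apply, Matrix.one_apply]
    simp [Fin.castLE_inj, eq_comm]
  refine ⟨C * V * J, V * J, ?_⟩
  calc C = C * (V * Vᵀ) := hCV.symm
    _ = C * V * (J * Jᵀ) * Vᵀ := by rw [hJ, Matrix.mul_one, Matrix.mul_assoc]
    _ = C * V * J * (V * J)ᵀ := by simp only [transpose_mul, Matrix.mul_assoc]

theorem rank_prod_le (θ : Factors n k) (x : Fin n) : (θ.prod x).rank ≤ k :=
  (rank_mul_le_left _ _).trans (rank_le_width _)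

/-- Without columns the penalty cannot decrease. -/
theorem pos_of_hasDescentDirection {q : Fin n → Fin n → Fin n → ℝ}
    {B : Fin n → Matrix (Fin n) (Fin n) ℝ} (hB : IsLowRankTarget k q B) {P : Factors n k → ℝ}
    (hdesc : ∀ θ : Factors n k, IsCheapestFactorization P B θ → HasDescentDirection P θ) :
    0 < k := by
  rcases Nat.eq_zero_or_pos k with rfl | h
  · obtain ⟨⟨θ, hθ⟩, huniq⟩ := hB
    have hsub : ∀ a b : Factors n 0, a = b := fun a b => Subsingleton.elim a b
    obtain ⟨v, c, hc, hev⟩ := hdesc θ ⟨huniq θ hθ, fun θ' _ => le_of_eq (by rw [hsub θ θ'])⟩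
    have h2 : ∀ᶠ z in 𝓝 θ ×ˢ 𝓝[>] (0 : ℝ), 0 < z.2 :=
      tendsto_snd.eventually self_mem_nhdsWithin
    obtain ⟨z, hz1, hz2⟩ := (hev.and h2).exists
    rw [hsub (z.1 + z.2 • v) z.1] at hz1
    nlinarith
  · exact h

theorem prod_update (θ : Factors n k) (x : Fin n) (R S : Fin n → Fin k → ℝ) :
    Factors.prod (Function.update θ.1 x R, Function.update θ.2 x S) =
      Function.update θ.prod x (Matrix.of R * (Matrix.of S)ᵀ) := by
  funext y
  by_cases hy : y = x
  · subst hy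
    simp only [Factors.prod, Function.update_self]
  · simp only [Factors.prod, Function.update_of_ne hy]

theorem productLoss_update (q : Fin n → Fin n → Fin n → ℝ) (B : Fin n → Matrix (Fin n) (Fin n) ℝ)
    (x : Fin n) (C : Matrix (Fin n) (Fin n) ℝ) :
    productLoss q (Function.update B x C) =
      productLoss q B - frobSq (P3x1 q x - B x * P21 q) + frobSq (P3x1 q x - C * P21 q) := by
  unfold productLoss
  rw [← Finset.add_sum_erase _ _ (Finset.mem_univ x), ← Finset.add_sum_erase _ _ (Finset.mem_univ x),
    Function.update_self]
  have : ∀ y ∈ Finset.univ.erase x, frobSq (P3x1 q y - Function.update B x C y * P21 q) =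
      frobSq (P3x1 q y - B y * P21 q) := fun y hy => by
    rw [Function.update_of_ne (Finset.ne_of_mem_erase hy)]
  rw [Finset.sum_congr rfl this]
  ring

/-- Replacing one factor pair of an identified target cannot improve, nor keep, the criterion. -/
theorem productLoss_lt_update {q : Fin n → Fin n → Fin n → ℝ}
    {B : Fin n → Matrix (Fin n) (Fin n) ℝ} (hB : IsLowRankTarget k q B) (x : Fin n)
    {C : Matrix (Fin n) (Fin n) ℝ} (hC : C.rank ≤ k) (hne : C ≠ B x) :
    frobSq (P3x1 q x - B x * P21 q) < frobSq (P3x1 q x - C * P21 q) := by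
  obtain ⟨⟨θ, hθ⟩, huniq⟩ := hB
  have hθB := huniq θ hθ
  obtain ⟨R, S, rfl⟩ := exists_factorization hC
  have h : Factors.prod (Function.update θ.1 x R, Function.update θ.2 x S) =
      Function.update θ.prod x (R * Sᵀ) := prod_update θ x R S
  by_contra! hle
  have hcrit : criterion q (Function.update θ.1 x R, Function.update θ.2 x S) ≤ criterion q θ := by
    rw [criterion_eq_productLoss, criterion_eq_productLoss, h, productLoss_update, hθB]
    linarith
  have := huniq _ fun θ' => hcrit.trans (hθ θ')
  rw [h] at this
  exact hne (by rw [← congrFun this x, Function.update_self])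

/-- If wᵀ P₂₁ = 0 with w ≠ 0, adding w to a column of S_x whose partner column in R_x is nonzero
changes the product but not the criterion, against identification. -/
theorem det_P21_ne_zero {q : Fin n → Fin n → Fin n → ℝ}
    {B : Fin n → Matrix (Fin n) (Fin n) ℝ} (hB : IsLowRankTarget k q B) (hk : 0 < k)
    (hrank : ∀ x, (B x).rank = k) : (P21 q).det ≠ 0 := by
  intro hdet
  obtain ⟨w, hw, hwQ⟩ := exists_vecMul_eq_zero_iff.2 hdet
  obtain ⟨x, hx⟩ := Function.ne_iff.1 hw
  obtain ⟨R, S, hRS⟩ := exists_factorization (hrank x).le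
  have hR : R ≠ 0 := by
    rintro rfl
    have h := hrank x
    rw [hRS, Matrix.zero_mul, rank_zero] at h
    omega
  obtain ⟨i, l, hil⟩ : ∃ i l, R i l ≠ 0 := by
    by_contra! h
    exact hR (by ext i l; exact h i l)
  let S' : Matrix (Fin n) (Fin k) ℝ := S + vecMulVec w (Pi.single l 1)
  have hS' : R * S'ᵀ = B x + vecMulVec (fun i => R i l) w := by
    simp only [S', transpose_add, Matrix.mul_add, transpose_vecMulVec, mul_vecMulVec, ← hRS,
      mulVec_single_one]
    rfl
  have hlt := productLoss_lt_update hB x (C := R * S'ᵀ)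
    ((rank_mul_le_left _ _).trans (rank_le_width _)) (by
      rw [hS']
      intro h
      have := congrFun (congrFun h i) x
      rw [Matrix.add_apply, add_eq_left, vecMulVec_apply] at this
      exact (mul_ne_zero hil hx) this)
  rw [hS', Matrix.add_mul, vecMulVec_mul, hwQ, vecMulVec_zero, add_zero] at hlt
  exact lt_irrefl _ hlt

/-- Quadratic growth of the limiting criterion at the identified target. -/
theorem criterion_growth {q : Fin n → Fin n → Fin n → ℝ}
    {B : Fin n → Matrix (Fin n) (Fin n) ℝ} (hB : IsLowRankTarget k q B) (hk : 0 < k)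
    (hrank : ∀ x, (B x).rank = k) :
    ∃ c : ℝ, 0 < c ∧ ∀ θ : Factors n k,
      productLoss q B + c * familyDist θ.prod B ^ 2 ≤ criterion q θ := by
  have hdet := det_P21_ne_zero hB hk hrank
  have hunit : IsUnit (P21 q).det := isUnit_iff_ne_zero.2 hdet
  have hloc : ∀ x, ∃ c : ℝ, 0 < c ∧ ∀ C : Matrix (Fin n) (Fin n) ℝ, C.rank ≤ k →
      frobSq (P3x1 q x - B x * P21 q) + c * frobSq (C - B x) ≤ frobSq (P3x1 q x - C * P21 q) := by
    intro x
    -- Right multiplication by the invertible P₂₁ is a bijection of the matrices of rank at most k.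
    -- Undoing it costs the factor ‖P₂₁⁻¹‖² in the constant.
    obtain ⟨c, hc, hgrow⟩ := frobSq_sub_growth (P3x1 q x) (B x * P21 q) hk
      (by rw [rank_mul_eq_left_of_isUnit_det _ _ hunit, hrank x]) (fun C' hC' hne => by
        have h1 : C' * (P21 q)⁻¹ * P21 q = C' := by
          rw [Matrix.mul_assoc, nonsing_inv_mul _ hunit, Matrix.mul_one]
        have := productLoss_lt_update hB x (C := C' * (P21 q)⁻¹)
          ((rank_mul_le_left _ _).trans hC') (fun h => hne (by rw [← h1, h]))
        rwa [h1] at this)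
    have hI := frobSq_nonneg (P21 q)⁻¹
    refine ⟨c / (frobSq (P21 q)⁻¹ + 1), by positivity, fun C hC => ?_⟩
    have h1 := hgrow (C * P21 q) ((rank_mul_le_left _ _).trans hC)
    have h2 : frobSq (C - B x) ≤ frobSq (C * P21 q - B x * P21 q) * frobSq (P21 q)⁻¹ := by
      have h3 : C - B x = (C * P21 q - B x * P21 q) * (P21 q)⁻¹ := by
        rw [← Matrix.sub_mul, Matrix.mul_assoc, mul_nonsing_inv _ hunit, Matrix.mul_one]
      conv_lhs => rw [h3]
      exact frobSq_mul_le _ _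
    have h4 : c / (frobSq (P21 q)⁻¹ + 1) * frobSq (C - B x) ≤
        c * frobSq (C * P21 q - B x * P21 q) := by
      rw [div_mul_eq_mul_div, div_le_iff₀ (by positivity), mul_assoc]
      refine mul_le_mul_of_nonneg_left (h2.trans ?_) hc.le
      exact mul_le_mul_of_nonneg_left (by linarith) (frobSq_nonneg _)
    linarith
  choose c hc hgrow using hloc
  rcases Nat.eq_zero_or_pos n with rfl | hn
  · refine ⟨1, one_pos, fun θ => ?_⟩
    rw [familyDist_sq, criterion_eq_productLoss]
    simp [productLoss]
  · have : Nonempty (Fin n) := ⟨⟨0, hn⟩⟩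
    obtain ⟨x₀, hx₀⟩ := Finite.exists_min c
    refine ⟨c x₀, hc x₀, fun θ => ?_⟩
    rw [familyDist_sq, criterion_eq_productLoss, productLoss, productLoss, Finset.mul_sum,
      ← Finset.sum_add_distrib]
    refine Finset.sum_le_sum fun x _ => le_trans ?_ (hgrow x _ (rank_prod_le θ x))
    linarith [mul_le_mul_of_nonneg_right (hx₀ x) (frobSq_nonneg (θ.prod x - B x))]

end Target

/-! ### Dependence of the criterion on the table -/

section Perturbation

variable {n k : ℕ}

theorem abs_mul_apply_le {ι κ : Type*} [Fintype ι] {n : ℕ} {X : Matrix ι (Fin n) ℝ}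
    {Y : Matrix (Fin n) κ ℝ} {a b : ℝ} (ha : 0 ≤ a) (hX : ∀ i l, |X i l| ≤ a)
    (hY : ∀ l j, |Y l j| ≤ b) (i : ι) (j : κ) : |(X * Y) i j| ≤ n * (a * b) := by
  rw [Matrix.mul_apply]
  refine (Finset.abs_sum_le_sum_abs _ _).trans ?_
  refine (Finset.sum_le_card_nsmul _ _ (a * b) fun l _ => ?_).trans ?_
  · rw [abs_mul]
    exact mul_le_mul (hX i l) (hY l j) (abs_nonneg _) ha
  · simp

theorem abs_P21_sub_le {q q' : Fin n → Fin n → Fin n → ℝ} {Δ : ℝ}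
    (h : ∀ a b c, |q' a b c - q a b c| ≤ Δ) (i j : Fin n) :
    |(P21 q' - P21 q) i j| ≤ n * Δ := by
  simp only [P21, Matrix.sub_apply, of_apply, ← Finset.sum_sub_distrib]
  refine (Finset.abs_sum_le_sum_abs _ _).trans ?_
  refine (Finset.sum_le_card_nsmul _ _ Δ fun l _ => h _ _ _).trans ?_
  simp

/-- The squared residuals at B cancel in the increment, so every remaining term carries a factor B'
- B. This is what makes the fluctuation proportional to the distance of the products. -/
theorem productLoss_sub (q : Fin n → Fin n → Fin n → ℝ) (B' B : Fin n → Matrix (Fin n) (Fin n) ℝ) :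
    productLoss q B' - productLoss q B = ∑ x, ∑ i, ∑ j,
      ((((B' x - B x) * P21 q) i j) ^ 2 -
        2 * (P3x1 q x - B x * P21 q) i j * ((B' x - B x) * P21 q) i j) := by
  simp only [productLoss, frobSq, ← Finset.sum_sub_distrib]
  refine Finset.sum_congr rfl fun x _ => Finset.sum_congr rfl fun i _ =>
    Finset.sum_congr rfl fun j _ => ?_
  simp only [Matrix.sub_mul, Matrix.sub_apply]
  ring

/-- The increments of the criterion depend on the table in a Lipschitz way. -/
theorem exists_productLoss_increment_bound (q : Fin n → Fin n → Fin n → ℝ)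
    (B : Fin n → Matrix (Fin n) (Fin n) ℝ) :
    ∃ C : ℝ, 0 ≤ C ∧ ∀ (q' : Fin n → Fin n → Fin n → ℝ) (Δ : ℝ), 0 ≤ Δ → Δ ≤ 1 →
      (∀ a b c, |q' a b c - q a b c| ≤ Δ) → ∀ B' : Fin n → Matrix (Fin n) (Fin n) ℝ,
      |(productLoss q' B' - productLoss q' B) - (productLoss q B' - productLoss q B)| ≤
        C * Δ * (familyDist B' B + familyDist B' B ^ 2) := by
  obtain ⟨M, hM0, hM⟩ : ∃ M : ℝ, 0 ≤ M ∧ ∀ i j, |P21 q i j| ≤ M :=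
    ⟨√(frobSq (P21 q)), Real.sqrt_nonneg _, fun i j => Real.abs_le_sqrt (sq_le_frobSq _ i j)⟩
  obtain ⟨b, hb0, hb⟩ : ∃ b : ℝ, 0 ≤ b ∧ ∀ x i j, |B x i j| ≤ b :=
    ⟨familyDist B 0, familyDist_nonneg _ _, fun x i j => by
      simpa using abs_sub_le_familyDist B 0 x i j⟩
  obtain ⟨ρ, hρ0, hρ⟩ : ∃ ρ : ℝ, 0 ≤ ρ ∧ ∀ x i j, |(P3x1 q x - B x * P21 q) i j| ≤ ρ :=
    ⟨familyDist (fun x => P3x1 q x - B x * P21 q) 0, familyDist_nonneg _ _, fun x i j => by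
      simpa using abs_sub_le_familyDist (fun x => P3x1 q x - B x * P21 q) 0 x i j⟩
  set m : ℝ := (n : ℝ) with hm
  have hm0 : 0 ≤ m := Nat.cast_nonneg n
  set K1 := m * m * (m * (2 * M + m)) with hK1
  set K2 := (1 + m * (b * m)) * (m * (M + m)) + ρ * (m * m) with hK2
  have hK10 : 0 ≤ K1 := by positivity
  have hK20 : 0 ≤ K2 := by positivity
  refine ⟨m * (m * (m * (K1 + 2 * K2))), by positivity, fun q' Δ hΔ0 hΔ1 hq' B' => ?_⟩
  set d := familyDist B' B with hd
  have hd0 : 0 ≤ d := familyDist_nonneg _ _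
  rw [productLoss_sub, productLoss_sub]
  simp only [← Finset.sum_sub_distrib]
  have key : ∀ x i j,
      |((((B' x - B x) * P21 q') i j) ^ 2 -
        2 * (P3x1 q' x - B x * P21 q') i j * ((B' x - B x) * P21 q') i j) -
      ((((B' x - B x) * P21 q) i j) ^ 2 -
        2 * (P3x1 q x - B x * P21 q) i j * ((B' x - B x) * P21 q) i j)| ≤
      (K1 + 2 * K2) * Δ * (d + d ^ 2) := by
    intro x i j
    have hE : ∀ i j, |(B' x - B x) i j| ≤ d := fun i j => abs_sub_le_familyDist B' B x i j
    have he : |((B' x - B x) * P21 q) i j| ≤ m * (d * M) := abs_mul_apply_le hd0 hE hM i j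
    have hde : |((B' x - B x) * P21 q') i j - ((B' x - B x) * P21 q) i j| ≤ m * (d * (m * Δ)) := by
      rw [← Matrix.sub_apply, ← Matrix.mul_sub]
      exact abs_mul_apply_le hd0 hE (abs_P21_sub_le hq') i j
    have hdr : |(P3x1 q' x - B x * P21 q') i j - (P3x1 q x - B x * P21 q) i j| ≤
        (1 + m * (b * m)) * Δ := by
      have h1 : (P3x1 q' x - B x * P21 q') i j - (P3x1 q x - B x * P21 q) i j =
          (q' j x i - q j x i) - (B x * (P21 q' - P21 q)) i j := by
        simp only [P3x1, Matrix.sub_apply, Matrix.mul_sub, of_apply]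
        ring
      rw [h1]
      have h2 := abs_mul_apply_le hb0 (hb x) (abs_P21_sub_le hq') i j
      have h3 := abs_sub (q' j x i - q j x i) ((B x * (P21 q' - P21 q)) i j)
      have h4 := hq' j x i
      have : (1 + m * (b * m)) * Δ = Δ + m * (b * (m * Δ)) := by ring
      linarith
    have hr := hρ x i j
    set e := ((B' x - B x) * P21 q) i j
    set e' := ((B' x - B x) * P21 q') i j
    set r := (P3x1 q x - B x * P21 q) i j
    set r' := (P3x1 q' x - B x * P21 q') i j
    have he' : |e'| ≤ m * (d * (M + m)) := by
      have h1 : |e'| ≤ |e' - e| + |e| := by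
        have := abs_add_le (e' - e) e
        rwa [sub_add_cancel] at this
      have h2 : m * (d * (m * Δ)) ≤ m * (d * m) := by
        have : m * Δ ≤ m := mul_le_of_le_one_right hm0 hΔ1
        gcongr
      have : m * (d * (M + m)) = m * (d * M) + m * (d * m) := by ring
      linarith
    -- Each term contains one difference between the tables, of order Δ. The first contains two
    -- factors of order d (constant `K1`), the others one (constant `K2`).
    have hsplit : (e' ^ 2 - 2 * r' * e') - (e ^ 2 - 2 * r * e) =
        (e' - e) * (e' + e) - 2 * ((r' - r) * e' + r * (e' - e)) := by ring
    rw [hsplit]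
    have h1 : |(e' - e) * (e' + e)| ≤ K1 * Δ * d ^ 2 := by
      rw [abs_mul]
      have h2 : |e' + e| ≤ m * (d * (2 * M + m)) := by
        have := abs_add_le e' e
        have h3 : m * (d * (2 * M + m)) = m * (d * (M + m)) + m * (d * M) := by ring
        linarith
      refine (mul_le_mul hde h2 (abs_nonneg _) (by positivity)).trans (le_of_eq ?_)
      rw [hK1]; ring
    have h2 : |(r' - r) * e' + r * (e' - e)| ≤ K2 * Δ * d := by
      refine (abs_add_le _ _).trans ?_
      rw [abs_mul, abs_mul]
      have h3 := mul_le_mul hdr he' (abs_nonneg _) (by positivity)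
      have h4 := mul_le_mul hr hde (abs_nonneg _) hρ0
      have : K2 * Δ * d = (1 + m * (b * m)) * Δ * (m * (d * (M + m))) +
          ρ * (m * (d * (m * Δ))) := by rw [hK2]; ring
      linarith
    have h3 := abs_sub ((e' - e) * (e' + e)) (2 * ((r' - r) * e' + r * (e' - e)))
    rw [abs_mul (2 : ℝ), abs_two] at h3
    have h4 : (0 : ℝ) ≤ K1 * Δ * d := by positivity
    have h5 : (0 : ℝ) ≤ K2 * Δ * d ^ 2 := by positivity
    linarith
  refine (Finset.abs_sum_le_sum_abs _ _).trans ?_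
  refine (Finset.sum_le_card_nsmul _ _ (m * (m * ((K1 + 2 * K2) * Δ * (d + d ^ 2))))
    fun x _ => ?_).trans (le_of_eq ?_)
  · refine (Finset.abs_sum_le_sum_abs _ _).trans ?_
    refine (Finset.sum_le_card_nsmul _ _ (m * ((K1 + 2 * K2) * Δ * (d + d ^ 2)))
      fun i _ => ?_).trans (le_of_eq ?_)
    · refine (Finset.abs_sum_le_sum_abs _ _).trans ?_
      refine (Finset.sum_le_card_nsmul _ _ _ fun j _ => key x i j).trans (le_of_eq ?_)
      simp [hm]
    · simp [hm]
  · simp only [Finset.card_univ, Fintype.card_fin, nsmul_eq_mul]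
    ring

end Perturbation

/-! ### Retraction onto the factorisations of a full-rank family -/

section Retraction

variable {n k : ℕ}

theorem exists_leftInverse_of_rank {R : Matrix (Fin n) (Fin k) ℝ} (hR : R.rank = k) :
    ∃ X : Matrix (Fin n) (Fin k) ℝ, Xᵀ * R = 1 := by
  have h1 : (Rᵀ * R).rank = k := by rw [rank_transpose_mul_self, hR]
  have h2 : IsUnit (Rᵀ * R) := by
    rw [← mulVec_injective_iff_isUnit, ← coe_mulVecLin, ← LinearMap.ker_eq_bot,
      ← Submodule.finrank_eq_zero]
    have h3 := LinearMap.finrank_range_add_finrank_ker (Rᵀ * R).mulVecLin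
    rw [Module.finrank_fintype_fun_eq_card, Fintype.card_fin] at h3
    have h4 : (Rᵀ * R).rank = Module.finrank ℝ (Rᵀ * R).mulVecLin.range := rfl
    omega
  refine ⟨((Rᵀ * R)⁻¹ * Rᵀ)ᵀ, ?_⟩
  rw [transpose_transpose, Matrix.mul_assoc]
  exact nonsing_inv_mul _ ((isUnit_iff_isUnit_det _).1 h2)

theorem continuous_frobSq {ι κ : Type*} [Fintype ι] [Fintype κ] :
    Continuous (frobSq : Matrix ι κ ℝ → ℝ) := by
  unfold frobSq
  fun_prop

/-- The bound k + 1 is any number above ‖1‖² = k, so it persists near `x₀` by continuity of the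
inverse. -/
theorem eventually_inv_bounded {α : Type*} [TopologicalSpace α] {x₀ : α}
    {M : α → Matrix (Fin k) (Fin k) ℝ} (hM : ContinuousAt M x₀) (h1 : M x₀ = 1) :
    ∀ᶠ x in 𝓝 x₀, IsUnit (M x).det ∧ frobSq (M x)⁻¹ ≤ k + 1 := by
  have hdet : ContinuousAt (fun x => (M x).det) x₀ :=
    (continuous_id.matrix_det.continuousAt).comp hM
  have hdet0 : (M x₀).det ≠ 0 := by rw [h1, det_one]; exact one_ne_zero
  have hinv : ContinuousAt (fun x => (M x)⁻¹) x₀ := by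
    simp only [Matrix.inv_def, Ring.inverse_eq_inv']
    exact (hdet.inv₀ hdet0).smul ((continuous_id.matrix_adjugate.continuousAt).comp hM)
  have hf : ContinuousAt (fun x => frobSq (M x)⁻¹) x₀ := continuous_frobSq.continuousAt.comp hinv
  have hval : frobSq (M x₀)⁻¹ < k + 1 := by
    rw [h1, inv_one, frobSq_eq_trace, transpose_one, Matrix.mul_one, trace_one, Fintype.card_fin]
    linarith
  filter_upwards [hdet.eventually_ne hdet0, hf.eventually_lt_const hval] with x hx1 hx2
  exact ⟨isUnit_iff_ne_zero.2 hx1, hx2.le⟩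

/-- Near a factorisation of full rank, the distance to the set of factorisations of the same matrix
is bounded by the distance of the products. -/
theorem exists_factor_retraction {R₀ S₀ : Matrix (Fin n) (Fin k) ℝ} (h : (R₀ * S₀ᵀ).rank = k) :
    ∃ K : ℝ, 0 ≤ K ∧ ∀ᶠ z : Matrix (Fin n) (Fin k) ℝ × Matrix (Fin n) (Fin k) ℝ in 𝓝 (R₀, S₀),
      ∃ R S : Matrix (Fin n) (Fin k) ℝ, R * Sᵀ = R₀ * S₀ᵀ ∧
        frobSq (R - z.1) ≤ K * frobSq (z.1 * z.2ᵀ - R₀ * S₀ᵀ) ∧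
        frobSq (S - z.2) ≤ K * frobSq (z.1 * z.2ᵀ - R₀ * S₀ᵀ) := by
  have hR : R₀.rank = k := le_antisymm (rank_le_width _) (by
    conv_lhs => rw [← h]
    exact rank_mul_le_left _ _)
  have hS : S₀.rank = k := le_antisymm (rank_le_width _) (by
    conv_lhs => rw [← h]
    exact (rank_mul_le_right _ _).trans_eq (rank_transpose _))
  obtain ⟨X, hX⟩ := exists_leftInverse_of_rank hR
  obtain ⟨Y, hY⟩ := exists_leftInverse_of_rank hS
  have hM : ContinuousAt (fun z : Matrix (Fin n) (Fin k) ℝ × Matrix (Fin n) (Fin k) ℝ =>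
      Xᵀ * z.1) (R₀, S₀) := (continuous_const.matrix_mul continuous_fst).continuousAt
  have hN : ContinuousAt (fun z : Matrix (Fin n) (Fin k) ℝ × Matrix (Fin n) (Fin k) ℝ =>
      z.2ᵀ * Y) (R₀, S₀) :=
    (continuous_snd.matrix_transpose.matrix_mul continuous_const).continuousAt
  have hN1 : S₀ᵀ * Y = 1 := by
    rw [← transpose_inj, transpose_mul, transpose_transpose, hY, transpose_one]
  have hX0 := frobSq_nonneg X
  have hY0 := frobSq_nonneg Y
  have hP0 := frobSq_nonneg (R₀ * Xᵀ - 1)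
  set K1 := frobSq (R₀ * Xᵀ - 1) * (frobSq Y * (k + 1))
  set K2 := (k + 1 : ℝ) * frobSq X
  have hK1 : 0 ≤ K1 := by positivity
  have hK2 : 0 ≤ K2 := by positivity
  refine ⟨K1 + K2, by positivity, ?_⟩
  filter_upwards [eventually_inv_bounded hM hX, eventually_inv_bounded hN hN1]
    with z ⟨hMu, hMb⟩ ⟨hNu, hNb⟩
  have hf := frobSq_nonneg (z.1 * z.2ᵀ - R₀ * S₀ᵀ)
  -- The factorisations (R₀ G, S₀ G⁻ᵀ) all have the same product; G = Xᵀ z.1 is the choice that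
  -- matches R₀ G to z.1, where X is a left inverse of R₀.
  refine ⟨R₀ * (Xᵀ * z.1), S₀ * ((Xᵀ * z.1)⁻¹)ᵀ, ?_, ?_, ?_⟩
  · rw [transpose_mul, transpose_transpose]
    calc R₀ * (Xᵀ * z.1) * ((Xᵀ * z.1)⁻¹ * S₀ᵀ)
        = R₀ * ((Xᵀ * z.1) * (Xᵀ * z.1)⁻¹) * S₀ᵀ := by simp only [Matrix.mul_assoc]
      _ = R₀ * S₀ᵀ := by rw [mul_nonsing_inv _ hMu, Matrix.mul_one]
  -- R₀ Xᵀ - 1 annihilates R₀ S₀ᵀ, and z.1 is recovered linearly from its product with z.2ᵀ, so the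
  -- error is a bounded linear image of the difference of the products.
  · have h1 : R₀ * (Xᵀ * z.1) - z.1 =
        (R₀ * Xᵀ - 1) * ((z.1 * z.2ᵀ - R₀ * S₀ᵀ) * (Y * (z.2ᵀ * Y)⁻¹)) := by
      have h2 : (R₀ * Xᵀ - 1) * (R₀ * S₀ᵀ) = 0 := by
        have : (R₀ * Xᵀ - 1) * (R₀ * S₀ᵀ) = R₀ * (Xᵀ * R₀) * S₀ᵀ - R₀ * S₀ᵀ := by
          simp only [Matrix.sub_mul, Matrix.one_mul, Matrix.mul_assoc]
        rw [this, hX, Matrix.mul_one, sub_self]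
      have h3 : z.1 * z.2ᵀ * (Y * (z.2ᵀ * Y)⁻¹) = z.1 := by
        have : z.1 * z.2ᵀ * (Y * (z.2ᵀ * Y)⁻¹) = z.1 * ((z.2ᵀ * Y) * (z.2ᵀ * Y)⁻¹) := by
          simp only [Matrix.mul_assoc]
        rw [this, mul_nonsing_inv _ hNu, Matrix.mul_one]
      rw [Matrix.sub_mul (z.1 * z.2ᵀ), h3, Matrix.mul_sub, ← Matrix.mul_assoc _ (R₀ * S₀ᵀ), h2,
        Matrix.zero_mul, sub_zero, Matrix.sub_mul, Matrix.one_mul, Matrix.mul_assoc]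
    rw [h1]
    calc _ ≤ frobSq (R₀ * Xᵀ - 1) * (frobSq (z.1 * z.2ᵀ - R₀ * S₀ᵀ) *
          (frobSq Y * frobSq (z.2ᵀ * Y)⁻¹)) := by
          refine (frobSq_mul_le _ _).trans (mul_le_mul_of_nonneg_left ?_ hP0)
          refine (frobSq_mul_le _ _).trans (mul_le_mul_of_nonneg_left ?_ hf)
          exact frobSq_mul_le _ _
      _ ≤ frobSq (R₀ * Xᵀ - 1) * (frobSq (z.1 * z.2ᵀ - R₀ * S₀ᵀ) * (frobSq Y * (k + 1))) := by
          gcongr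
      _ = K1 * frobSq (z.1 * z.2ᵀ - R₀ * S₀ᵀ) := by simp only [K1]; ring
      _ ≤ _ := by nlinarith
  · have h1 : (S₀ * ((Xᵀ * z.1)⁻¹)ᵀ - z.2)ᵀ =
        (Xᵀ * z.1)⁻¹ * (Xᵀ * (-(z.1 * z.2ᵀ - R₀ * S₀ᵀ))) := by
      rw [neg_sub, transpose_sub, transpose_mul, transpose_transpose, Matrix.mul_sub Xᵀ,
        ← Matrix.mul_assoc Xᵀ, hX, Matrix.one_mul, Matrix.mul_sub, ← Matrix.mul_assoc Xᵀ,
        ← Matrix.mul_assoc, nonsing_inv_mul _ hMu, Matrix.one_mul]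
    rw [← frobSq_transpose, h1]
    calc _ ≤ frobSq (Xᵀ * z.1)⁻¹ * (frobSq X * frobSq (z.1 * z.2ᵀ - R₀ * S₀ᵀ)) := by
          refine (frobSq_mul_le _ _).trans
            (mul_le_mul_of_nonneg_left ?_ (frobSq_nonneg _))
          refine (frobSq_mul_le _ _).trans ?_
          rw [frobSq_transpose, frobSq_neg]
      _ ≤ (k + 1) * (frobSq X * frobSq (z.1 * z.2ᵀ - R₀ * S₀ᵀ)) := by gcongr
      _ = K2 * frobSq (z.1 * z.2ᵀ - R₀ * S₀ᵀ) := by simp only [K2]; ring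
      _ ≤ _ := by nlinarith

theorem Factors.norm_le {θ : Factors n k} {e : ℝ} (he : 0 ≤ e) (h1 : ∀ x i l, |θ.1 x i l| ≤ e)
    (h2 : ∀ x i l, |θ.2 x i l| ≤ e) : ‖θ‖ ≤ e := by
  refine norm_prod_le_iff.2 ⟨?_, ?_⟩
  · simpa only [pi_norm_le_iff_of_nonneg he, Real.norm_eq_abs] using h1
  · simpa only [pi_norm_le_iff_of_nonneg he, Real.norm_eq_abs] using h2

theorem Factors.abs_fst_le (θ : Factors n k) (x i : Fin n) (l : Fin k) : |θ.1 x i l| ≤ ‖θ‖ :=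
  (norm_le_pi_norm (θ.1 x i) l).trans <| (norm_le_pi_norm (θ.1 x) i).trans <|
    (norm_le_pi_norm θ.1 x).trans (norm_fst_le θ)

theorem Factors.abs_snd_le (θ : Factors n k) (x i : Fin n) (l : Fin k) : |θ.2 x i l| ≤ ‖θ‖ :=
  (norm_le_pi_norm (θ.2 x i) l).trans <| (norm_le_pi_norm (θ.2 x) i).trans <|
    (norm_le_pi_norm θ.2 x).trans (norm_snd_le θ)

/-- Near a factorisation of a family of rank `k`, the distance to the set of factorisations of this
family is bounded by the distance of the products. -/
theorem exists_retraction {B : Fin n → Matrix (Fin n) (Fin n) ℝ} (hrank : ∀ x, (B x).rank = k)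
    {θ₀ : Factors n k} (hθ₀ : θ₀.prod = B) :
    ∃ C : ℝ, 0 ≤ C ∧ ∀ᶠ θ in 𝓝 θ₀, ∃ θ' : Factors n k, θ'.prod = B ∧
      ‖θ' - θ‖ ≤ C * familyDist θ.prod B := by
  have hx : ∀ x, (Matrix.of (θ₀.1 x) * (Matrix.of (θ₀.2 x))ᵀ) = B x := fun x => congrFun hθ₀ x
  have h1 : ∀ x, ∃ K : ℝ, 0 ≤ K ∧ ∀ᶠ θ : Factors n k in 𝓝 θ₀,
      ∃ R S : Matrix (Fin n) (Fin k) ℝ, R * Sᵀ = B x ∧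
        frobSq (R - Matrix.of (θ.1 x)) ≤ K * frobSq (θ.prod x - B x) ∧
        frobSq (S - Matrix.of (θ.2 x)) ≤ K * frobSq (θ.prod x - B x) := by
    intro x
    obtain ⟨K, hK, hev⟩ := exists_factor_retraction (R₀ := Matrix.of (θ₀.1 x))
      (S₀ := Matrix.of (θ₀.2 x)) (by rw [hx, hrank])
    refine ⟨K, hK, ?_⟩
    have hcont : ContinuousAt (fun θ : Factors n k =>
        ((Matrix.of (θ.1 x), Matrix.of (θ.2 x)) :
          Matrix (Fin n) (Fin k) ℝ × Matrix (Fin n) (Fin k) ℝ)) θ₀ := by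
      refine Continuous.continuousAt (Continuous.prodMk ?_ ?_)
      · exact (continuous_apply x).comp continuous_fst
      · exact (continuous_apply x).comp continuous_snd
    filter_upwards [hcont.eventually hev] with θ hθ
    rw [hx] at hθ
    exact hθ
  choose K hK hev using h1
  refine ⟨√(∑ x, K x), Real.sqrt_nonneg _, ?_⟩
  filter_upwards [eventually_all.2 hev] with θ hθ
  choose R S hRS hR hS using hθ
  have hbound : ∀ x (Z : Matrix (Fin n) (Fin k) ℝ), frobSq Z ≤ K x * frobSq (θ.prod x - B x) →
      ∀ i l, |Z i l| ≤ √(∑ x, K x) * familyDist θ.prod B := by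
    intro x Z hZ i l
    rw [familyDist, ← Real.sqrt_mul (Finset.sum_nonneg fun x _ => hK x)]
    refine Real.abs_le_sqrt ((sq_le_frobSq Z i l).trans (hZ.trans ?_))
    exact mul_le_mul (Finset.single_le_sum (fun x _ => hK x) (Finset.mem_univ x))
      (Finset.single_le_sum (f := fun x => frobSq (θ.prod x - B x))
        (fun _ _ => frobSq_nonneg _) (Finset.mem_univ x)) (frobSq_nonneg _)
      (Finset.sum_nonneg fun x _ => hK x)
  refine ⟨(fun x => R x, fun x => S x), funext fun x => hRS x, ?_⟩
  refine Factors.norm_le (mul_nonneg (Real.sqrt_nonneg _) (familyDist_nonneg _ _)) ?_ ?_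
  · exact fun x i l => hbound x _ (hR x) i l
  · exact fun x i l => hbound x _ (hS x) i l

end Retraction

/-! ### First-order condition and quadratic upper bound -/

section Deterministic

variable {n k : ℕ}

theorem Factors.prod_apply (θ : Factors n k) (x i j : Fin n) :
    θ.prod x i j = ∑ l, θ.1 x i l * θ.2 x j l := rfl

theorem continuous_familyDist_prod (B : Fin n → Matrix (Fin n) (Fin n) ℝ) :
    Continuous fun θ : Factors n k => familyDist θ.prod B := by
  simp only [familyDist, frobSq, Matrix.sub_apply, Factors.prod_apply]
  fun_prop

theorem abs_prod_sub_le {θ θ' : Factors n k} {K : ℝ} (hθ : ‖θ‖ ≤ K) (hθ' : ‖θ'‖ ≤ K)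
    (x i j : Fin n) : |θ'.prod x i j - θ.prod x i j| ≤ k * (2 * K * ‖θ' - θ‖) := by
  have hK : 0 ≤ K := (norm_nonneg θ).trans hθ
  rw [Factors.prod_apply, Factors.prod_apply, ← Finset.sum_sub_distrib]
  refine (Finset.abs_sum_le_sum_abs _ _).trans ?_
  refine (Finset.sum_le_card_nsmul _ _ (2 * K * ‖θ' - θ‖) fun l _ => ?_).trans (by simp)
  have h1 : θ'.1 x i l * θ'.2 x j l - θ.1 x i l * θ.2 x j l =
      (θ' - θ).1 x i l * θ'.2 x j l + θ.1 x i l * (θ' - θ).2 x j l := by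
    simp only [Prod.fst_sub, Prod.snd_sub, Pi.sub_apply]
    ring
  rw [h1]
  refine (abs_add_le _ _).trans ?_
  rw [abs_mul, abs_mul]
  have h2 := mul_le_mul ((θ' - θ).abs_fst_le x i l) ((θ'.abs_snd_le x j l).trans hθ')
    (abs_nonneg _) (norm_nonneg _)
  have h3 := mul_le_mul ((θ.abs_fst_le x i l).trans hθ) ((θ' - θ).abs_snd_le x j l)
    (abs_nonneg _) hK
  linarith

theorem productLoss_le_criterion {q : Fin n → Fin n → Fin n → ℝ}
    {B : Fin n → Matrix (Fin n) (Fin n) ℝ} (hB : IsLowRankTarget k q B) (θ : Factors n k) :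
    productLoss q B ≤ criterion q θ := by
  obtain ⟨⟨θ', hθ'⟩, huniq⟩ := hB
  rw [← huniq θ' hθ', ← criterion_eq_productLoss]
  exact hθ' θ

/-- The derivative of the criterion in the direction of a family of matrices, up to a factor. -/
def lossSlope (q : Fin n → Fin n → Fin n → ℝ) (B E : Fin n → Matrix (Fin n) (Fin n) ℝ) : ℝ :=
  ∑ x, ∑ i, ∑ j, (P3x1 q x - B x * P21 q) i j * (E x * P21 q) i j

theorem lossSlope_add (q : Fin n → Fin n → Fin n → ℝ)
    (B E E' : Fin n → Matrix (Fin n) (Fin n) ℝ) :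
    lossSlope q B (E + E') = lossSlope q B E + lossSlope q B E' := by
  simp only [lossSlope, ← Finset.sum_add_distrib, Pi.add_apply, Matrix.add_mul]
  refine Finset.sum_congr rfl fun x _ => Finset.sum_congr rfl fun i _ =>
    Finset.sum_congr rfl fun j _ => ?_
  rw [Matrix.add_apply]
  ring

theorem lossSlope_smul (q : Fin n → Fin n → Fin n → ℝ) (s : ℝ)
    (B E : Fin n → Matrix (Fin n) (Fin n) ℝ) :
    lossSlope q B (s • E) = s * lossSlope q B E := by
  simp only [lossSlope, Finset.mul_sum, Pi.smul_apply, Matrix.smul_mul]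
  refine Finset.sum_congr rfl fun x _ => Finset.sum_congr rfl fun i _ =>
    Finset.sum_congr rfl fun j _ => ?_
  rw [Matrix.smul_apply, smul_eq_mul]
  ring

theorem productLoss_add (q : Fin n → Fin n → Fin n → ℝ)
    (B E : Fin n → Matrix (Fin n) (Fin n) ℝ) :
    productLoss q (B + E) =
      productLoss q B + ∑ x, frobSq (E x * P21 q) - 2 * lossSlope q B E := by
  have h := productLoss_sub q (B + E) B
  have h2 : ∀ x, (B + E) x - B x = E x := fun x => by simp
  simp only [h2, Finset.sum_sub_distrib] at h
  have h3 : ∑ x, ∑ i, ∑ j, 2 * (P3x1 q x - B x * P21 q) i j * (E x * P21 q) i j =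
      2 * lossSlope q B E := by
    simp only [lossSlope, Finset.mul_sum, mul_assoc]
  rw [h3] at h
  have h4 : ∑ x, frobSq (E x * P21 q) = ∑ x, ∑ i, ∑ j, (E x * P21 q) i j ^ 2 := rfl
  linarith

/-- For small s the linear term dominates; s = b / (|a| + 1) is small enough. -/
theorem eq_zero_of_forall_le {a b : ℝ} (h : ∀ s : ℝ, 2 * s * b ≤ s ^ 2 * a) : b = 0 := by
  by_contra hb
  have hM : 0 < |a| + 1 := by positivity
  have h1 := h (b / (|a| + 1))
  have h2 : (b / (|a| + 1)) ^ 2 * a ≤ (b / (|a| + 1)) ^ 2 * (|a| + 1) :=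
    mul_le_mul_of_nonneg_left (by linarith [le_abs_self a]) (sq_nonneg _)
  have h3 : (b / (|a| + 1)) ^ 2 * (|a| + 1) = b ^ 2 / (|a| + 1) := by field_simp
  have h4 : 2 * (b / (|a| + 1)) * b = 2 * (b ^ 2 / (|a| + 1)) := by ring
  have h5 : 0 < b ^ 2 / (|a| + 1) := by positivity
  linarith

/-- First-order condition at an identified target. -/
theorem lossSlope_eq_zero {q : Fin n → Fin n → Fin n → ℝ}
    {B : Fin n → Matrix (Fin n) (Fin n) ℝ} (hB : IsLowRankTarget k q B)
    (E : Fin n → Matrix (Fin n) (Fin n) ℝ)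
    (hE : ∀ s : ℝ, ∃ θ : Factors n k, θ.prod = B + s • E) : lossSlope q B E = 0 := by
  -- All points B + sE are admissible products, and on this line the criterion is a quadratic
  -- polynomial in s with its minimum at s = 0.
  refine eq_zero_of_forall_le (a := ∑ x, frobSq (E x * P21 q)) fun s => ?_
  obtain ⟨θ, hθ⟩ := hE s
  have h := productLoss_le_criterion hB θ
  rw [criterion_eq_productLoss, hθ, productLoss_add, lossSlope_smul] at h
  have h2 : ∑ x, frobSq ((s • E) x * P21 q) = s ^ 2 * ∑ x, frobSq (E x * P21 q) := by
    rw [Finset.mul_sum]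
    refine Finset.sum_congr rfl fun x _ => ?_
    rw [Pi.smul_apply, Matrix.smul_mul]
    simp only [frobSq, Matrix.smul_apply, smul_eq_mul, mul_pow, Finset.mul_sum]
  rw [h2] at h
  linarith

theorem exists_abs_lossSlope_le (q : Fin n → Fin n → Fin n → ℝ)
    (B : Fin n → Matrix (Fin n) (Fin n) ℝ) :
    ∃ C : ℝ, 0 ≤ C ∧ ∀ (E : Fin n → Matrix (Fin n) (Fin n) ℝ) (e : ℝ), 0 ≤ e →
      (∀ x i j, |E x i j| ≤ e) → |lossSlope q B E| ≤ C * e := by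
  obtain ⟨M, hM0, hM⟩ : ∃ M : ℝ, 0 ≤ M ∧ ∀ i j, |P21 q i j| ≤ M :=
    ⟨√(frobSq (P21 q)), Real.sqrt_nonneg _, fun i j => Real.abs_le_sqrt (sq_le_frobSq _ i j)⟩
  refine ⟨∑ x, ∑ i, ∑ j, |(P3x1 q x - B x * P21 q) i j| * (n * M), by positivity,
    fun E e he hE => ?_⟩
  simp only [lossSlope, Finset.sum_mul]
  refine (Finset.abs_sum_le_sum_abs _ _).trans (Finset.sum_le_sum fun x _ => ?_)
  refine (Finset.abs_sum_le_sum_abs _ _).trans (Finset.sum_le_sum fun i _ => ?_)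
  refine (Finset.abs_sum_le_sum_abs _ _).trans (Finset.sum_le_sum fun j _ => ?_)
  rw [abs_mul, mul_assoc]
  refine mul_le_mul_of_nonneg_left ?_ (abs_nonneg _)
  refine (abs_mul_apply_le he (hE x) hM i j).trans (le_of_eq (by ring))

/-- Near a factorisation of the identified target, the excess of the limiting criterion is at most
quadratic in the distance of the products. -/
theorem exists_criterion_upper {q : Fin n → Fin n → Fin n → ℝ}
    {B : Fin n → Matrix (Fin n) (Fin n) ℝ} (hB : IsLowRankTarget k q B)
    (hrank : ∀ x, (B x).rank = k) {θ₀ : Factors n k} (hθ₀ : θ₀.prod = B) :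
    ∃ C : ℝ, 0 ≤ C ∧ ∀ᶠ θ in 𝓝 θ₀,
      criterion q θ ≤ productLoss q B + C * familyDist θ.prod B ^ 2 := by
  obtain ⟨C₁, hC₁, hev⟩ := exists_retraction hrank hθ₀
  obtain ⟨C₂, hC₂, hslope⟩ := exists_abs_lossSlope_le q B
  have hf := frobSq_nonneg (P21 q)
  refine ⟨frobSq (P21 q) + 2 * (C₂ * (k * (C₁ * C₁))), by positivity, ?_⟩
  filter_upwards [hev] with θ ⟨θ', hθ', hdist⟩
  set d := familyDist θ.prod B with hd
  let ρ : Fin n → Matrix (Fin n) (Fin k) ℝ := fun x => Matrix.of (θ.1 x) - Matrix.of (θ'.1 x)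
  let σ : Fin n → Matrix (Fin n) (Fin k) ℝ := fun x => Matrix.of (θ.2 x) - Matrix.of (θ'.2 x)
  -- Expansion of the product around the exact factorisation θ': E₁ and E₂ move one factor, E₃ is
  -- the second-order remainder.
  let E₁ : Fin n → Matrix (Fin n) (Fin n) ℝ := fun x => ρ x * (Matrix.of (θ'.2 x))ᵀ
  let E₂ : Fin n → Matrix (Fin n) (Fin n) ℝ := fun x => Matrix.of (θ'.1 x) * (σ x)ᵀ
  let E₃ : Fin n → Matrix (Fin n) (Fin n) ℝ := fun x => ρ x * (σ x)ᵀ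
  have hB' : ∀ x, B x = Matrix.of (θ'.1 x) * (Matrix.of (θ'.2 x))ᵀ := fun x =>
    (congrFun hθ' x).symm
  have hprod : θ.prod = B + (E₁ + E₂ + E₃) := by
    funext x
    have h1 : Matrix.of (θ.1 x) = Matrix.of (θ'.1 x) + ρ x := by simp [ρ]
    have h2 : Matrix.of (θ.2 x) = Matrix.of (θ'.2 x) + σ x := by simp [σ]
    simp only [Factors.prod, Pi.add_apply, E₁, E₂, E₃, hB' x]
    rw [h1, h2]
    simp only [Matrix.add_mul, Matrix.mul_add, transpose_add]
    abel
  -- Moving one factor linearly keeps a product of k-column matrices for every s, so the slope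
  -- vanishes along E₁ and E₂. Only E₃, of size O(d²), contributes.
  have h1 : lossSlope q B E₁ = 0 := lossSlope_eq_zero hB E₁ fun s =>
    ⟨(fun x => Matrix.of (θ'.1 x) + s • ρ x, θ'.2), by
      funext x
      have : Factors.prod (fun x => Matrix.of (θ'.1 x) + s • ρ x, θ'.2) x =
        (Matrix.of (θ'.1 x) + s • ρ x) * (Matrix.of (θ'.2 x))ᵀ := rfl
      rw [this, Pi.add_apply, hB' x, Matrix.add_mul, Matrix.smul_mul]
      rfl⟩
  have h2 : lossSlope q B E₂ = 0 := lossSlope_eq_zero hB E₂ fun s =>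
    ⟨(θ'.1, fun x => Matrix.of (θ'.2 x) + s • σ x), by
      funext x
      have : Factors.prod (θ'.1, fun x => Matrix.of (θ'.2 x) + s • σ x) x =
        Matrix.of (θ'.1 x) * (Matrix.of (θ'.2 x) + s • σ x)ᵀ := rfl
      rw [this, Pi.add_apply, hB' x, transpose_add, transpose_smul, Matrix.mul_add,
        Matrix.mul_smul]
      rfl⟩
  have hd0 : 0 ≤ d := familyDist_nonneg _ _
  have h3 : |lossSlope q B E₃| ≤ C₂ * (k * ((C₁ * d) * (C₁ * d))) := by
    refine hslope _ _ (by positivity) fun x i j => ?_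
    refine abs_mul_apply_le (by positivity) (fun i l => ?_) (fun l j => ?_) i j
    · exact ((θ - θ').abs_fst_le x i l).trans (norm_sub_rev θ θ' ▸ hdist)
    · exact ((θ - θ').abs_snd_le x j l).trans (norm_sub_rev θ θ' ▸ hdist)
  have h4 : ∑ x, frobSq ((E₁ + E₂ + E₃) x * P21 q) ≤ frobSq (P21 q) * d ^ 2 := by
    rw [hd, familyDist_sq, Finset.mul_sum]
    refine Finset.sum_le_sum fun x _ => ?_
    have hx : θ.prod x - B x = (E₁ + E₂ + E₃) x := by
      rw [hprod]
      exact add_sub_cancel_left _ _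
    rw [hx, mul_comm]
    exact frobSq_mul_le _ _
  rw [criterion_eq_productLoss, hprod, productLoss_add, lossSlope_add, lossSlope_add, h1, h2]
  have h5 := (abs_le.1 h3).1
  have h6 : C₂ * (k * ((C₁ * d) * (C₁ * d))) = C₂ * (k * (C₁ * C₁)) * d ^ 2 := by ring
  rw [h6] at h5
  linarith

end Deterministic

/-! ### Deterministic error bounds for penalised minimisers -/

section Rates

variable {n k : ℕ}

/-- On bounded sets of factors, the least penalty of a factorisation of `B` exceeds the penalty at
`θ` by at most a multiple of the distance of the products. -/
theorem exists_penalty_comparison {B : Fin n → Matrix (Fin n) (Fin n) ℝ}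
    (hrank : ∀ x, (B x).rank = k) {P : Factors n k → ℝ} (hLip : LocallyLipschitz P) (K : ℝ) :
    ∃ C : ℝ, 0 ≤ C ∧ ∀ θ : Factors n k, ‖θ‖ ≤ K → C * familyDist θ.prod B < 1 →
      ∃ θ' : Factors n k, θ'.prod = B ∧ P θ' ≤ P θ + C * familyDist θ.prod B := by
  have hcompact := isCompact_closedBall (0 : Factors n k) K
  suffices h : ∃ C : ℝ, 0 ≤ C ∧ ∀ θ ∈ Metric.closedBall (0 : Factors n k) K,
      C * familyDist θ.prod B < 1 →
      ∃ θ' : Factors n k, θ'.prod = B ∧ P θ' ≤ P θ + C * familyDist θ.prod B by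
    obtain ⟨C, hC, h⟩ := h
    exact ⟨C, hC, fun θ hθ => h θ (mem_closedBall_zero_iff.2 hθ)⟩
  refine hcompact.induction_on (p := fun s => ∃ C : ℝ, 0 ≤ C ∧ ∀ θ ∈ s,
      C * familyDist θ.prod B < 1 →
      ∃ θ' : Factors n k, θ'.prod = B ∧ P θ' ≤ P θ + C * familyDist θ.prod B) ?_ ?_ ?_ ?_
  · exact ⟨0, le_rfl, fun θ hθ => hθ.elim⟩
  · exact fun s t hst ⟨C, hC, h⟩ => ⟨C, hC, fun θ hθ => h θ (hst hθ)⟩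
  · rintro s t ⟨C, hC, h⟩ ⟨C', hC', h'⟩
    refine ⟨max C C', le_max_of_le_left hC, fun θ hθ hlt => ?_⟩
    have hd := familyDist_nonneg θ.prod B
    have h1 := mul_le_mul_of_nonneg_right (le_max_left C C') hd
    have h2 := mul_le_mul_of_nonneg_right (le_max_right C C') hd
    rcases hθ with hθ | hθ
    · obtain ⟨θ', hθ', hP⟩ := h θ hθ (by linarith)
      exact ⟨θ', hθ', by linarith⟩
    · obtain ⟨θ', hθ', hP⟩ := h' θ hθ (by linarith)
      exact ⟨θ', hθ', by linarith⟩
  · intro θ₀ _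
    have hcont : Tendsto (fun θ : Factors n k => familyDist θ.prod B) (𝓝 θ₀)
        (𝓝 (familyDist θ₀.prod B)) := (continuous_familyDist_prod B).continuousAt
    by_cases hθ₀ : θ₀.prod = B
    · obtain ⟨C, hC, hev⟩ := exists_retraction hrank hθ₀
      obtain ⟨L, t, ht, hL⟩ := hLip θ₀
      obtain ⟨ε, hε, hball⟩ := Metric.mem_nhds_iff.1 ht
      have h0 : familyDist θ₀.prod B = 0 := by simp [hθ₀, familyDist, frobSq]
      rw [h0] at hcont
      have hsmall : ∀ᶠ θ : Factors n k in 𝓝 θ₀, C * familyDist θ.prod B < ε / 2 := by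
        have := hcont.const_mul C
        rw [mul_zero] at this
        exact this.eventually_lt_const (by linarith)
      refine ⟨_, mem_nhdsWithin_of_mem_nhds (hev.and (hsmall.and (Metric.ball_mem_nhds θ₀
        (half_pos hε)))), L * C, by positivity, ?_⟩
      rintro θ ⟨⟨θ', hθ', hdist⟩, hlt, hθ⟩ -
      refine ⟨θ', hθ', ?_⟩
      have h1 : θ ∈ t := hball (Metric.ball_subset_ball (by linarith) hθ)
      have h2 : θ' ∈ t := hball (by
        rw [Metric.mem_ball]
        have h3 := dist_triangle θ' θ θ₀
        rw [dist_eq_norm θ' θ] at h3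
        have h4 := Metric.mem_ball.1 hθ
        linarith)
      have h5 := hL.dist_le_mul θ' h2 θ h1
      rw [Real.dist_eq, dist_eq_norm] at h5
      have h6 := mul_le_mul_of_nonneg_left hdist L.coe_nonneg
      have h7 := le_abs_self (P θ' - P θ)
      linarith [mul_assoc (L : ℝ) C (familyDist θ.prod B)]
    · have hpos : 0 < familyDist θ₀.prod B :=
        (familyDist_nonneg _ _).lt_of_ne fun h => hθ₀ (familyDist_eq_zero h.symm)
      -- Away from the factorisations of B, this constant makes the condition C d < 1 fail, so
      -- nothing is to be shown.
      refine ⟨_, mem_nhdsWithin_of_mem_nhds (hcont.eventually_const_lt (half_lt_self hpos)),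
        2 / familyDist θ₀.prod B, by positivity, fun θ hθ hlt => ?_⟩
      have hθ' : familyDist θ₀.prod B / 2 < familyDist θ.prod B := hθ
      rw [div_mul_eq_mul_div, div_lt_one hpos] at hlt
      linarith

theorem le_div_of_mul_sq_le {c a d : ℝ} (hc : 0 < c) (ha : 0 ≤ a) (hd : 0 ≤ d)
    (h : c * d ^ 2 ≤ a * d) : d ≤ a / c := by
  rcases hd.eq_or_lt with rfl | hd
  · positivity
  · rw [le_div_iff₀ hc]
    have : (d * c) * d ≤ a * d := by linarith
    exact le_of_mul_le_mul_right this hd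

/-- Minimisers of the criterion penalised with weight `τ`, for a table at distance `Δ` from the
true one, have products within `O(Δ + τ)` of the target. -/
theorem exists_minimizer_error_bound {q : Fin n → Fin n → Fin n → ℝ}
    {B : Fin n → Matrix (Fin n) (Fin n) ℝ} (hB : IsLowRankTarget k q B) (hk : 0 < k)
    (hrank : ∀ x, (B x).rank = k) {P : Factors n k → ℝ} (hLip : LocallyLipschitz P)
    (hproper : IsProperPenalty P) :
    ∃ C δ : ℝ, 0 ≤ C ∧ 0 < δ ∧ ∀ (q' : Fin n → Fin n → Fin n → ℝ) (Δ τ : ℝ) (θ : Factors n k),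
      0 ≤ Δ → Δ ≤ δ → 0 ≤ τ → τ ≤ δ → (∀ a b c, |q' a b c - q a b c| ≤ Δ) →
      IsMinimizer (fun θ => criterion q' θ + τ * P θ) θ →
      familyDist θ.prod B ≤ C * (Δ + τ) := by
  obtain ⟨c, hc, hgrow⟩ := criterion_growth hB hk hrank
  obtain ⟨C₁, hC₁, hinc⟩ := exists_productLoss_increment_bound q B
  obtain ⟨θ₁, hθ₁⟩ := hB.1
  have hθ₁B := hB.2 θ₁ hθ₁
  obtain ⟨⟨m₀, hm₀⟩, hprop⟩ := hproper
  have hm₀' : ∀ θ, m₀ ≤ P θ := fun θ => hm₀ ⟨θ, rfl⟩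
  set b := familyDist B 0 with hb
  -- Products within distance 1 of B have entries at most b + 1.
  obtain ⟨K, hK⟩ := hprop (max (P θ₁) (b + 1))
  obtain ⟨C₂, hC₂, hcomp⟩ := exists_penalty_comparison hrank hLip K
  set G := P θ₁ - m₀ with hG
  have hG0 : 0 ≤ G := sub_nonneg.2 (hm₀' θ₁)
  -- radius within which the comparison of penalties is available
  set η := 1 / (C₂ + 2) with hη
  have hη0 : 0 < η := by positivity
  have hη1 : η ≤ 1 := by
    rw [hη, div_le_one (by positivity)]; linarith
  have hηC : C₂ * η < 1 := by
    rw [hη, mul_one_div, div_lt_one (by positivity)]; linarith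
  -- The first two bounds make the increment estimate valid and let c d² / 2 absorb C₁ Δ d²; the
  -- last two force d ≤ η.
  set δ := min (min 1 (c / (2 * (C₁ + 1)))) (min (c * η / (8 * (C₁ + 1)))
    (c * η ^ 2 / (8 * (G + 1)))) with hδ
  refine ⟨2 * (C₁ + C₂) / c, δ, by positivity, by positivity,
    fun q' Δ τ θ hΔ0 hΔδ hτ0 hτδ hq' hmin => ?_⟩
  have hΔ1 : Δ ≤ 1 := hΔδ.trans ((min_le_left _ _).trans (min_le_left _ _))
  have hΔ2 : Δ * (2 * (C₁ + 1)) ≤ c := by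
    rw [← le_div_iff₀ (by positivity)]
    exact hΔδ.trans ((min_le_left _ _).trans (min_le_right _ _))
  have hΔ3 : Δ * (8 * (C₁ + 1)) ≤ c * η := by
    rw [← le_div_iff₀ (by positivity)]
    exact hΔδ.trans ((min_le_right _ _).trans (min_le_left _ _))
  have hτ1 : τ * (8 * (G + 1)) ≤ c * η ^ 2 := by
    rw [← le_div_iff₀ (by positivity)]
    exact hτδ.trans ((min_le_right _ _).trans (min_le_right _ _))
  set d := familyDist θ.prod B with hd
  have hd0 : 0 ≤ d := familyDist_nonneg _ _
  -- Basic inequality: minimality against a factorisation θ' of B, combined with growth and the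
  -- increment bound.
  have hbasic : ∀ θ' : Factors n k, θ'.prod = B →
      c / 2 * d ^ 2 ≤ C₁ * Δ * d + τ * (P θ' - P θ) := by
    intro θ' hθ'
    have h1 := hmin θ'
    simp only [criterion_eq_productLoss, hθ'] at h1
    have h2 := hgrow θ
    rw [criterion_eq_productLoss] at h2
    have h3 := (abs_le.1 (hinc q' Δ hΔ0 hΔ1 hq' θ.prod)).1
    have h4 : C₁ * Δ * d ^ 2 ≤ c / 2 * d ^ 2 := by
      refine mul_le_mul_of_nonneg_right ?_ (sq_nonneg d)
      nlinarith
    rw [← hd] at h2 h3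
    nlinarith
  have hbig : 2 * (C₁ * Δ + C₂ * τ) / c ≤ 2 * (C₁ + C₂) / c * (Δ + τ) := by
    rw [div_mul_eq_mul_div]
    refine div_le_div_of_nonneg_right ?_ hc.le
    nlinarith [mul_nonneg hC₁ hτ0, mul_nonneg hC₂ hΔ0]
  have hfinish : c / 2 * d ^ 2 ≤ (C₁ * Δ + C₂ * τ) * d → d ≤ 2 * (C₁ + C₂) / c * (Δ + τ) := by
    intro h
    refine (le_div_of_mul_sq_le (by positivity) (by positivity) hd0 h).trans ?_
    refine le_trans (le_of_eq ?_) hbig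
    field_simp
  -- If θ costs at least as much as θ₁, the penalty term has the favourable sign. Otherwise θ lies
  -- in a fixed sublevel set, and may be replaced by a bounded pair with the same products.
  rcases le_total (P θ₁) (P θ) with hP | hP
  · refine hfinish ?_
    have h1 := hbasic θ₁ hθ₁B
    have h2 : τ * (P θ₁ - P θ) ≤ 0 := mul_nonpos_of_nonneg_of_nonpos hτ0 (by linarith)
    have h3 : 0 ≤ C₂ * τ * d := by positivity
    linarith
  · have hdη : d ≤ η := by
      by_contra! hlt
      have h1 := hbasic θ₁ hθ₁B
      have h2 : τ * (P θ₁ - P θ) ≤ τ * (G + 1) :=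
        mul_le_mul_of_nonneg_left (by linarith [hm₀' θ]) hτ0
      have h3 : C₁ * Δ * d ≤ c * η / 8 * d := by
        refine mul_le_mul_of_nonneg_right ?_ hd0
        nlinarith
      have h4 : η * d ≤ d ^ 2 := by nlinarith
      have h5 : η ^ 2 ≤ d ^ 2 := by nlinarith
      have h6 : 0 < c * d ^ 2 := by
        have : 0 < d := hη0.trans hlt
        positivity
      nlinarith
    obtain ⟨θ', hθ', hPθ', hnorm⟩ := hK θ (hP.trans (le_max_left _ _)) fun x i j => by
      have h1 := abs_sub_le_familyDist θ.prod B x i j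
      have h2 := abs_sub_le_familyDist B 0 x i j
      simp only [Pi.zero_apply, Matrix.zero_apply, sub_zero] at h2
      have h3 := abs_add_le (θ.prod x i j - B x i j) (B x i j)
      rw [sub_add_cancel] at h3
      exact (by linarith : _ ≤ b + 1).trans (le_max_right _ _)
    obtain ⟨θ'', hθ'', hPθ''⟩ := hcomp θ' hnorm (by
      rw [hθ']
      exact (mul_le_mul_of_nonneg_left hdη hC₂).trans_lt hηC)
    rw [hθ', ← hd] at hPθ''
    refine hfinish ((hbasic θ'' hθ'').trans ?_)
    have h1 : τ * (P θ'' - P θ) ≤ τ * (C₂ * d) := mul_le_mul_of_nonneg_left (by linarith) hτ0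
    linarith

/-- A penalty decaying more slowly than `N^{-1/2}` prevents its minimisers from having products
within `O(N^{-1/2})` of the target. -/
theorem not_eventually_exists_fast_minimizer {q : Fin n → Fin n → Fin n → ℝ}
    {B : Fin n → Matrix (Fin n) (Fin n) ℝ} (hB : IsLowRankTarget k q B)
    (hrank : ∀ x, (B x).rank = k) {P : Factors n k → ℝ} (hLip : LocallyLipschitz P)
    (hproper : IsProperPenalty P)
    (hdesc : ∀ θ : Factors n k, IsCheapestFactorization P B θ → HasDescentDirection P θ)
    {lam p : ℝ} (hlam : 0 < lam) (hp : p < 1 / 2) {K : ℝ} (hK : 0 ≤ K) :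
    ¬ ∀ᶠ N : ℕ in atTop, ∃ (q' : Fin n → Fin n → Fin n → ℝ) (θ : Factors n k),
      (∀ a b c, |q' a b c - q a b c| ≤ K / √N) ∧ familyDist θ.prod B ≤ K / √N ∧
      IsMinimizer (penalizedCriterion q' P lam p N) θ := by
  intro hev
  obtain ⟨C₁, hC₁, hinc⟩ := exists_productLoss_increment_bound q B
  have hrpow : ∀ {r : ℝ}, 0 < r → Tendsto (fun N : ℕ => lam * (N : ℝ) ^ r) atTop atTop :=
    fun hr => ((tendsto_rpow_atTop hr).comp tendsto_natCast_atTop_atTop).const_mul_atTop hlam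
  have hsqrt : Tendsto (fun N : ℕ => √(N : ℝ)) atTop atTop :=
    Real.tendsto_sqrt_atTop.comp tendsto_natCast_atTop_atTop
  set A := C₁ * K * (K + K ^ 2) with hA
  have hA0 : 0 ≤ A := by positivity
  -- the fluctuation of the criterion is of order `1 / N`
  have hfluct : ∀ {N : ℕ} {K' : ℝ} {q' : Fin n → Fin n → Fin n → ℝ}
      {B' : Fin n → Matrix (Fin n) (Fin n) ℝ}, 1 ≤ N → K ≤ √N → 0 ≤ K' →
      (∀ a b c, |q' a b c - q a b c| ≤ K / √N) → familyDist B' B ≤ K' / √N →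
      |(productLoss q' B' - productLoss q' B) - (productLoss q B' - productLoss q B)| ≤
        C₁ * K * (K' + K' ^ 2) / N := by
    intro N K' q' B' hN hKN hK' hq' hd
    have hN0 : (1 : ℝ) ≤ N := by exact_mod_cast hN
    have hs1 : 1 ≤ √(N : ℝ) := Real.one_le_sqrt.2 hN0
    have hs : 0 < √(N : ℝ) := by linarith
    have hss : √(N : ℝ) * √N = N := Real.mul_self_sqrt (by linarith)
    refine (hinc q' (K / √N) (by positivity) ((div_le_one hs).2 hKN) hq' B').trans ?_
    have h1 : familyDist B' B ^ 2 ≤ K' ^ 2 / √N := by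
      have h2 : familyDist B' B ^ 2 ≤ (K' / √N) ^ 2 :=
        pow_le_pow_left₀ (familyDist_nonneg _ _) hd 2
      refine h2.trans ?_
      rw [div_pow]
      refine div_le_div_of_nonneg_left (sq_nonneg _) hs ?_
      nlinarith
    have h3 : C₁ * K * (K' + K' ^ 2) / N = C₁ * (K / √N) * (K' / √N + K' ^ 2 / √N) := by
      have h4 : C₁ * K * (K' + K' ^ 2) / N = C₁ * K * (K' + K' ^ 2) / (√N * √N) := by rw [hss]
      rw [h4]; ring
    rw [h3]
    exact mul_le_mul_of_nonneg_left (add_le_add hd h1) (by positivity)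
  obtain ⟨θ₁, hθ₁⟩ := hB.1
  have hθ₁B := hB.2 θ₁ hθ₁
  set b := familyDist B 0 with hb
  obtain ⟨K₂, hK₂⟩ := hproper.2 (max (P θ₁ + 1) (b + K))
  -- bounded minimisers, asymptotically as cheap as any factorisation of the target
  have hev' : ∀ᶠ N : ℕ in atTop, ∃ θ : Factors n k, ∃ q' : Fin n → Fin n → Fin n → ℝ,
      (∀ a b c, |q' a b c - q a b c| ≤ K / √N) ∧ familyDist θ.prod B ≤ K / √N ∧
      IsMinimizer (penalizedCriterion q' P lam p N) θ ∧ ‖θ‖ ≤ K₂ ∧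
      ∀ θ' : Factors n k, θ'.prod = B → P θ ≤ P θ' + A / (lam * (N : ℝ) ^ (1 - p)) := by
    filter_upwards [hev, eventually_ge_atTop 1, hsqrt.eventually_ge_atTop K,
      (hrpow (by linarith : 0 < 1 - p)).eventually_ge_atTop (A + 1)]
      with N ⟨q', θ, hq', hd, hmin⟩ hN hKN hNA
    have hN0 : (1 : ℝ) ≤ N := by exact_mod_cast hN
    have hs1 : 1 ≤ √(N : ℝ) := Real.one_le_sqrt.2 hN0
    -- The criterion at θ falls below its value at B by at most A / N; division by the weight λ
    -- N^{-p} leaves an excess penalty of order N^{p-1}, which tends to 0.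
    have hcheap : ∀ θ' : Factors n k, θ'.prod = B →
        P θ ≤ P θ' + A / (lam * (N : ℝ) ^ (1 - p)) := by
      intro θ' hθ'
      have h1 := hmin θ'
      simp only [penalizedCriterion, criterion_eq_productLoss, hθ'] at h1
      have h2 := productLoss_le_criterion hB θ
      rw [criterion_eq_productLoss] at h2
      have h3 := (abs_le.1 (hfluct hN hKN hK hq' hd)).1
      have h4 : lam * (N : ℝ) ^ (-p) * (P θ - P θ') ≤ A / N := by
        rw [hA]; linarith
      have h5 : (N : ℝ) ^ (1 - p) = N * (N : ℝ) ^ (-p) := by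
        rw [sub_eq_add_neg, Real.rpow_add (by linarith), Real.rpow_one]
      have h6 : 0 < (N : ℝ) ^ (-p) := Real.rpow_pos_of_pos (by linarith) _
      rw [← sub_le_iff_le_add', le_div_iff₀ (by positivity), h5]
      rw [le_div_iff₀ (by linarith)] at h4
      linarith
    have hPθ : P θ ≤ P θ₁ + 1 := by
      have h1 : A / (lam * (N : ℝ) ^ (1 - p)) ≤ 1 := by
        rw [div_le_one (by linarith)]; linarith
      linarith [hcheap θ₁ hθ₁B]
    obtain ⟨θ', hθ', hPθ', hnorm⟩ := hK₂ θ (hPθ.trans (le_max_left _ _)) fun x i j => by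
      have h1 := abs_sub_le_familyDist θ.prod B x i j
      have h2 := abs_sub_le_familyDist B 0 x i j
      simp only [Pi.zero_apply, Matrix.zero_apply, sub_zero] at h2
      have h3 := abs_add_le (θ.prod x i j - B x i j) (B x i j)
      rw [sub_add_cancel] at h3
      have h4 : K / √N ≤ K := div_le_self hK hs1
      exact (by linarith : _ ≤ b + K).trans (le_max_right _ _)
    refine ⟨θ', q', hq', hθ' ▸ hd, fun ζ => le_trans ?_ (hmin ζ), hnorm,
      fun ζ hζ => hPθ'.trans (hcheap ζ hζ)⟩
    simp only [penalizedCriterion, criterion_eq_productLoss, hθ']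
    have : 0 ≤ lam * (N : ℝ) ^ (-p) := by positivity
    linarith [mul_le_mul_of_nonneg_left hPθ' this]
  obtain ⟨N₀, hN₀⟩ := eventually_atTop.1 hev'
  choose u q' hq' hd hmin hnorm hcheap using fun N : ℕ => hN₀ (N + N₀) (Nat.le_add_left _ _)
  obtain ⟨θ, -, φ, hφ, hlim⟩ := (isCompact_closedBall (0 : Factors n k) K₂).tendsto_subseq
    (x := u) fun N => mem_closedBall_zero_iff.2 (hnorm N)
  have hsub : Tendsto (fun j => φ j + N₀) atTop atTop :=
    (tendsto_add_atTop_nat N₀).comp hφ.tendsto_atTop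
  have hθB : θ.prod = B := by
    refine familyDist_eq_zero (le_antisymm ?_ (familyDist_nonneg _ _))
    refine le_of_tendsto_of_tendsto
      (((continuous_familyDist_prod B).tendsto θ).comp hlim)
      ((tendsto_const_nhds (x := K)).div_atTop (hsqrt.comp hsub)) ?_
    exact Eventually.of_forall fun j => hd (φ j)
  have hθcheap : IsCheapestFactorization P B θ := by
    refine ⟨hθB, fun θ' hθ' => ?_⟩
    have h1 : Tendsto (fun j => P θ' + A / (lam * ((φ j + N₀ : ℕ) : ℝ) ^ (1 - p))) atTop
        (𝓝 (P θ' + 0)) :=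
      tendsto_const_nhds.add ((tendsto_const_nhds (x := A)).div_atTop
        ((hrpow (by linarith : 0 < 1 - p)).comp hsub))
    rw [add_zero] at h1
    exact le_of_tendsto_of_tendsto ((hLip.continuous.tendsto θ).comp hlim) h1
      (Eventually.of_forall fun j => hcheap (φ j) θ' hθ')
  obtain ⟨v, c, hc, hdescent⟩ := hdesc θ hθcheap
  obtain ⟨C₃, hC₃, hupper⟩ := exists_criterion_upper hB hrank hθB
  -- The step has the order of the assumed error, so the moved point still has products within
  -- O(N^{-1/2}) of B.
  set t : ℕ → ℝ := fun j => 1 / √((φ j + N₀ : ℕ) : ℝ) with ht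
  have htlim : Tendsto t atTop (𝓝 0) :=
    (tendsto_const_nhds (x := (1 : ℝ))).div_atTop (hsqrt.comp hsub)
  have hpos : ∀ᶠ j in atTop, 0 < t j := by
    filter_upwards [hsub.eventually_ge_atTop 1] with j hj
    have : (0 : ℝ) < (φ j + N₀ : ℕ) := by exact_mod_cast hj
    exact one_div_pos.2 (Real.sqrt_pos.2 this)
  have hpair : Tendsto (fun j => (u (φ j), t j)) atTop (𝓝 θ ×ˢ 𝓝[>] (0 : ℝ)) :=
    hlim.prodMk (tendsto_nhdsWithin_iff.2 ⟨htlim, hpos⟩)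
  have hmove : Tendsto (fun j => u (φ j) + t j • v) atTop (𝓝 θ) := by
    simpa using hlim.add (htlim.smul_const v)
  have hK₂0 : 0 ≤ K₂ := (norm_nonneg _).trans (hnorm 0)
  set K₃ := K₂ + ‖v‖ with hK₃
  set K₄ := n ^ 2 * (k * (2 * K₃ * ‖v‖) + K) with hK₄
  have hK₄0 : 0 ≤ K₄ := by positivity
  -- D / N collects the excess of the limiting criterion at the moved point and the fluctuations at
  -- the moved point and at the minimiser. The penalty gains c λ N^{-p} / √N, which exceeds D / N
  -- once λ N^{1/2-p} > D / c.
  set D := C₃ * K₄ ^ 2 + C₁ * K * (K₄ + K₄ ^ 2) + A with hD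
  have hsmall : Tendsto (fun j => lam * ((φ j + N₀ : ℕ) : ℝ) ^ (1 / 2 - p)) atTop atTop :=
    (hrpow (by linarith : 0 < 1 / 2 - p)).comp hsub
  obtain ⟨j, hjd, hju, hjN, hjK, hjD⟩ := ((hpair.eventually hdescent).and
    ((hmove.eventually hupper).and ((hsub.eventually_ge_atTop 1).and
      (((hsqrt.comp hsub).eventually_ge_atTop K).and
        (hsmall.eventually_gt_atTop (D / c)))))).exists
  simp only [Function.comp_apply] at hjK
  have hj1 := hq' (φ j)
  have hj2 := hd (φ j)
  have hj3 := hmin (φ j) (u (φ j) + t j • v)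
  have hj4 := hnorm (φ j)
  simp only [ht] at hjd hju hj3
  clear_value K₄ A D
  set N := φ j + N₀ with hN
  set w := u (φ j)
  set r := q' (φ j)
  have hN0 : (1 : ℝ) ≤ N := by exact_mod_cast hjN
  have hs1 : 1 ≤ √(N : ℝ) := Real.one_le_sqrt.2 hN0
  have hs : 0 < √(N : ℝ) := by linarith
  have hss : √(N : ℝ) * √N = N := Real.mul_self_sqrt (by linarith)
  set z := w + (1 / √(N : ℝ)) • v with hz
  have hstep : ‖z - w‖ = ‖v‖ / √N := by
    rw [hz, add_sub_cancel_left, norm_smul, Real.norm_of_nonneg (by positivity)]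
    ring
  have hstep' : ‖v‖ / √(N : ℝ) ≤ ‖v‖ := div_le_self (norm_nonneg _) hs1
  have hznorm : ‖z‖ ≤ K₃ := by
    have := norm_add_le w (z - w)
    rw [add_sub_cancel] at this
    linarith
  have hzdist : familyDist z.prod B ≤ K₄ / √N := by
    have h1 : familyDist z.prod B ≤ n ^ 2 * ((k * (2 * K₃ * ‖v‖) + K) / √N) := by
      refine familyDist_le_of_abs_le (by positivity) fun x i j => ?_
      have h2 := abs_prod_sub_le (hj4.trans (by rw [hK₃]; linarith [norm_nonneg v])) hznorm x i j
      have h3 := (abs_sub_le_familyDist w.prod B x i j).trans hj2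
      have h4 := abs_sub_le (z.prod x i j) (w.prod x i j) (B x i j)
      rw [hstep] at h2
      have h5 : (k * (2 * K₃ * ‖v‖) + K) / √(N : ℝ) = k * (2 * K₃ * (‖v‖ / √N)) + K / √N := by
        ring
      linarith
    refine h1.trans (le_of_eq ?_)
    rw [hK₄]; ring
  have h1 := (abs_le.1 (hfluct hjN hjK hK hj1 hj2)).1
  have h2 := (abs_le.1 (hfluct hjN hjK hK₄0 hj1 hzdist)).2
  have h3 := productLoss_le_criterion hB w
  have h4 : C₃ * familyDist z.prod B ^ 2 ≤ C₃ * K₄ ^ 2 / N := by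
    have h5 : familyDist z.prod B ^ 2 ≤ (K₄ / √N) ^ 2 :=
      pow_le_pow_left₀ (familyDist_nonneg _ _) hzdist 2
    rw [div_pow, Real.sq_sqrt (by linarith)] at h5
    have := mul_le_mul_of_nonneg_left h5 hC₃
    rwa [← mul_div_assoc] at this
  simp only [penalizedCriterion, criterion_eq_productLoss] at hj3 hju h3
  have hτ : 0 < lam * (N : ℝ) ^ (-p) := mul_pos hlam (Real.rpow_pos_of_pos (by linarith) _)
  have h6 := mul_le_mul_of_nonneg_left hjd hτ.le
  have h7 : lam * (N : ℝ) ^ (-p) * (c * (1 / √N)) ≤ D / N := by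
    have h8 : D / N = C₃ * K₄ ^ 2 / N + C₁ * K * (K₄ + K₄ ^ 2) / N + A / N := by
      rw [hD]; ring
    rw [h8, hA]
    linarith
  have h9 : (N : ℝ) ^ (1 / 2 - p) = √N * (N : ℝ) ^ (-p) := by
    rw [sub_eq_add_neg, Real.rpow_add (by linarith), ← Real.sqrt_eq_rpow]
  rw [h9, div_lt_iff₀ hc] at hjD
  rw [le_div_iff₀ (by linarith)] at h7
  have h10 : lam * (N : ℝ) ^ (-p) * (c * (1 / √N)) * N = lam * (√N * (N : ℝ) ^ (-p)) * c := by
    nth_rewrite 3 [← hss]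
    field_simp
  linarith

end Rates

/-! ### Boundedness in probability and exact rates -/

section BoundedInProbability

variable {Ω : Type*} [MeasurableSpace Ω] {μ : Measure Ω}

theorem BoundedInProb.mono {Z Z' : ℕ → Ω → ℝ} (h : BoundedInProb μ Z)
    (hle : ∀ᶠ N in atTop, ∀ ω, |Z' N ω| ≤ |Z N ω|) : BoundedInProb μ Z' := by
  intro ε hε
  obtain ⟨K, hK⟩ := h ε hε
  refine ⟨K, ?_⟩
  filter_upwards [hK, hle] with N h1 h2
  exact (measure_mono fun ω (hω : K < |Z' N ω|) => hω.trans_le (h2 ω)).trans h1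

theorem BoundedInProb.add {Z Z' : ℕ → Ω → ℝ} (h : BoundedInProb μ Z) (h' : BoundedInProb μ Z') :
    BoundedInProb μ (fun N ω => Z N ω + Z' N ω) := by
  intro ε hε
  obtain ⟨K, hK⟩ := h (ε / 2) (half_pos hε)
  obtain ⟨K', hK'⟩ := h' (ε / 2) (half_pos hε)
  refine ⟨K + K', ?_⟩
  filter_upwards [hK, hK'] with N h1 h2
  have hsub : {ω | K + K' < |Z N ω + Z' N ω|} ⊆ {ω | K < |Z N ω|} ∪ {ω | K' < |Z' N ω|} := by
    intro ω hω
    by_contra hcon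
    rw [Set.mem_union, not_or] at hcon
    have h3 : |Z N ω| ≤ K := not_lt.1 hcon.1
    have h4 : |Z' N ω| ≤ K' := not_lt.1 hcon.2
    have h5 : K + K' < |Z N ω + Z' N ω| := hω
    linarith [abs_add_le (Z N ω) (Z' N ω)]
  refine (measure_mono hsub).trans ((measure_union_le _ _).trans ((add_le_add h1 h2).trans ?_))
  rw [← ENNReal.ofReal_add (by linarith) (by linarith), add_halves]

theorem BoundedInProb.sum {ι : Type*} (s : Finset ι) {Z : ι → ℕ → Ω → ℝ}
    (h : ∀ i, BoundedInProb μ (Z i)) : BoundedInProb μ (fun N ω => ∑ i ∈ s, Z i N ω) := by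
  classical
  induction s using Finset.induction_on with
  | empty =>
    intro ε _
    refine ⟨0, Eventually.of_forall fun N => ?_⟩
    simp
  | insert a s ha ih =>
    simp only [Finset.sum_insert ha]
    exact (h a).add ih

/-- Errors that are bounded in probability, but not negligible, after multiplication by `√N`. -/
theorem hasRate_sqrt {Z : ℕ → Ω → ℝ} (hup : BoundedInProb μ (fun N ω => √(N : ℝ) * Z N ω))
    {δ c : ℝ} (hδ : 0 < δ) (hc : 0 < c)
    (hlow : ∀ᶠ N : ℕ in atTop, ENNReal.ofReal c ≤ μ {ω | δ < √(N : ℝ) * |Z N ω|}) :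
    HasRate μ Z (fun N => Real.sqrt N) := by
  intro s
  constructor
  · intro h
    obtain ⟨K, hK⟩ := h (c / 2) (half_pos hc)
    -- If |s_N| exceeded this multiple of √N, then |s_N Z_N| > K on an event of probability at least
    -- c, while K was chosen for c / 2.
    refine Asymptotics.IsBigO.of_bound (max K 0 / δ) ?_
    filter_upwards [hK, hlow] with N h1 h2
    rw [Real.norm_eq_abs, Real.norm_of_nonneg (Real.sqrt_nonneg _)]
    by_contra! hlt
    have hsub : {ω | δ < √(N : ℝ) * |Z N ω|} ⊆ {ω | K < |s N * Z N ω|} := by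
      intro ω (hω : δ < √(N : ℝ) * |Z N ω|)
      have hZ : 0 < |Z N ω| := by
        by_contra! h0
        nlinarith [Real.sqrt_nonneg (N : ℝ), abs_nonneg (Z N ω)]
      have h3 := mul_lt_mul_of_pos_right hlt hZ
      have h4 : max K 0 ≤ max K 0 / δ * √(N : ℝ) * |Z N ω| := by
        rw [mul_assoc, div_mul_eq_mul_div, le_div_iff₀ hδ]
        exact mul_le_mul_of_nonneg_left hω.le (le_max_right _ _)
      change K < |s N * Z N ω|
      rw [abs_mul]
      exact ((le_max_left K 0).trans h4).trans_lt h3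
    have h5 := h2.trans ((measure_mono hsub).trans h1)
    rw [ENNReal.ofReal_le_ofReal_iff (by linarith)] at h5
    linarith
  · intro h ε hε
    obtain ⟨C, hC, hbound⟩ := h.exists_pos
    rw [Asymptotics.isBigOWith_iff] at hbound
    obtain ⟨K, hK⟩ := hup ε hε
    refine ⟨C * K, ?_⟩
    filter_upwards [hK, hbound] with N h1 h2
    refine (measure_mono fun ω (hω : C * K < |s N * Z N ω|) => ?_).trans h1
    change K < |√(N : ℝ) * Z N ω|
    rw [Real.norm_eq_abs, Real.norm_eq_abs] at h2
    rw [abs_mul] at hω ⊢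
    have h3 := mul_le_mul_of_nonneg_right h2 (abs_nonneg (Z N ω))
    have h4 : C * K < C * (|√(N : ℝ)| * |Z N ω|) := by linarith
    exact lt_of_mul_lt_mul_left h4 hC.le

/-- Convergence in distribution implies boundedness in probability. -/
theorem boundedInProb_of_tendstoInDistribution [IsProbabilityMeasure μ] {Z : ℕ → Ω → ℝ}
    {ν : Measure ℝ} [IsProbabilityMeasure ν]
    (h : TendstoInDistribution Z atTop (id : ℝ → ℝ) (fun _ => μ) ν) : BoundedInProb μ Z := by
  intro ε hε
  have hanti : Antitone fun K : ℕ => {x : ℝ | (K : ℝ) ≤ |x|} := fun a b hab x hx =>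
    show (a : ℝ) ≤ |x| from (Nat.cast_le.2 hab).trans (show (b : ℝ) ≤ |x| from hx)
  have hempty : ⋂ K : ℕ, {x : ℝ | (K : ℝ) ≤ |x|} = ∅ := by
    refine Set.eq_empty_of_forall_notMem fun x hx => ?_
    obtain ⟨K, hK⟩ := exists_nat_gt |x|
    exact absurd (Set.mem_iInter.1 hx K) (not_le.2 hK)
  have hclosed : ∀ K : ℕ, IsClosed {x : ℝ | (K : ℝ) ≤ |x|} := fun K =>
    isClosed_le continuous_const continuous_abs
  have hlim := tendsto_measure_iInter_atTop (μ := ν)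
    (fun K : ℕ => (hclosed K).measurableSet.nullMeasurableSet) hanti ⟨0, measure_ne_top _ _⟩
  rw [hempty, measure_empty] at hlim
  obtain ⟨K, hK⟩ := (hlim.eventually_lt_const (ENNReal.ofReal_pos.2 hε)).exists
  have hport := ProbabilityMeasure.limsup_measure_closed_le_of_tendsto h.tendsto (hclosed K)
  have hlt := hport.trans_lt (b := ((⟨ν.map id, Measure.isProbabilityMeasure_map
    h.aemeasurable_limit⟩ : ProbabilityMeasure ℝ) : Measure ℝ) {x : ℝ | (K : ℝ) ≤ |x|})
    (c := ENNReal.ofReal ε) (by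
      change (ν.map id) _ < _
      rwa [Measure.map_id])
  refine ⟨K, ?_⟩
  filter_upwards [eventually_lt_of_limsup_lt hlt] with N hN
  change (μ.map (Z N)) _ < _ at hN
  rw [Measure.map_apply_of_aemeasurable (h.forall_aemeasurable N) (hclosed K).measurableSet] at hN
  exact (measure_mono fun ω (hω : (K : ℝ) < |Z N ω|) => hω.le).trans hN.le

/-- Convergence in distribution to a nondegenerate Gaussian implies anti-concentration. -/
theorem exists_le_measure_of_tendstoInDistribution [IsProbabilityMeasure μ] {Z : ℕ → Ω → ℝ}
    {v : NNReal} (hv : v ≠ 0)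
    (h : TendstoInDistribution Z atTop (id : ℝ → ℝ) (fun _ => μ) (gaussianReal 0 v)) :
    ∃ c : ℝ, 0 < c ∧ ∀ᶠ N : ℕ in atTop, ENNReal.ofReal c ≤ μ {ω | 1 < |Z N ω|} := by
  have hopen : IsOpen {x : ℝ | 1 < |x|} := isOpen_lt continuous_const continuous_abs
  have hpos : 0 < gaussianReal 0 v {x : ℝ | 1 < |x|} := by
    refine pos_iff_ne_zero.2 fun h0 => ?_
    -- Lebesgue measure is absolutely continuous with respect to a nondegenerate Gaussian, so
    -- nonempty open sets are not null.
    have h1 := gaussianReal_absolutelyContinuous' 0 hv h0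
    exact (hopen.measure_pos volume ⟨2, by norm_num⟩).ne' h1
  obtain ⟨c, hc0, hc⟩ := ENNReal.lt_iff_exists_nnreal_btwn.1 hpos
  have hport := ProbabilityMeasure.le_liminf_measure_open_of_tendsto h.tendsto hopen
  have hlt := lt_of_lt_of_le (a := (c : ENNReal))
    (b := (((⟨(gaussianReal 0 v).map id, Measure.isProbabilityMeasure_map
      h.aemeasurable_limit⟩ : ProbabilityMeasure ℝ) : Measure ℝ) {x : ℝ | 1 < |x|})) (by
      change _ < ((gaussianReal 0 v).map id) _
      rwa [Measure.map_id]) hport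
  refine ⟨c, by exact_mod_cast hc0, ?_⟩
  filter_upwards [eventually_lt_of_lt_liminf hlt] with N hN
  change _ < (μ.map (Z N)) _ at hN
  rw [Measure.map_apply_of_aemeasurable (h.forall_aemeasurable N) hopen.measurableSet] at hN
  rw [ENNReal.ofReal_coe_nnreal]
  exact hN.le

end BoundedInProbability

/-! ### Central limit theorem for the empirical table -/

section Sample

theorem empiricalTable_eq {n : ℕ} {Ω : Type*} (X : ℕ → Ω → Fin n × Fin n × Fin n)
    (N : ℕ) (ω : Ω) (a b c : Fin n) :
    empiricalTable X N ω a b c =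
      (∑ l ∈ Finset.range N, if X l ω = (a, b, c) then (1 : ℝ) else 0) / N := by
  rw [empiricalTable, Finset.sum_boole]

theorem P1_empiricalTable {n : ℕ} {Ω : Type*} (X : ℕ → Ω → Fin n × Fin n × Fin n)
    (N : ℕ) (ω : Ω) (i : Fin n) :
    P1 (empiricalTable X N ω) i =
      (∑ l ∈ Finset.range N, if (X l ω).1 = i then (1 : ℝ) else 0) / N := by
  simp only [P1, empiricalTable_eq, ← Finset.sum_div]
  congr 1
  rw [Finset.sum_congr rfl fun b _ => Finset.sum_comm, Finset.sum_comm]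
  refine Finset.sum_congr rfl fun l _ => ?_
  obtain ⟨a, b, c⟩ := X l ω
  by_cases h : a = i
  · simp only [h, Prod.mk.injEq, true_and, if_true]
    rw [Finset.sum_eq_single b, Finset.sum_eq_single c] <;> simp +contextual [eq_comm]
  · simp [h]

variable {n : ℕ} {Ω : Type*} [MeasurableSpace Ω] {μ : Measure Ω} [IsProbabilityMeasure μ]
  {X : ℕ → Ω → Fin n × Fin n × Fin n} {q : Fin n → Fin n → Fin n → ℝ}

theorem integral_comp_triple (hX : ∀ l, Measurable (X l)) (hq : ∀ a b c, 0 ≤ q a b c)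
    (hlaw : ∀ l a b c, μ {ω | X l ω = (a, b, c)} = ENNReal.ofReal (q a b c))
    (f : Fin n × Fin n × Fin n → ℝ) (l : ℕ) :
    ∫ ω, f (X l ω) ∂μ = ∑ a, ∑ b, ∑ c, q a b c * f (a, b, c) := by
  have := Measure.isProbabilityMeasure_map (μ := μ) (hX l).aemeasurable
  rw [← integral_map (hX l).aemeasurable (measurable_of_finite f).aestronglyMeasurable,
    integral_fintype .of_finite, Fintype.sum_prod_type]
  refine Finset.sum_congr rfl fun a _ => ?_
  rw [Fintype.sum_prod_type]
  refine Finset.sum_congr rfl fun b _ => Finset.sum_congr rfl fun c _ => ?_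
  rw [Measure.real, Measure.map_apply (hX l) (measurableSet_singleton _)]
  have : X l ⁻¹' {(a, b, c)} = {ω | X l ω = (a, b, c)} := rfl
  rw [this, hlaw, ENNReal.toReal_ofReal (hq a b c), smul_eq_mul]

/-- The central limit theorem for functions of the sampled triplets. -/
theorem tendstoInDistribution_triple (hX : ∀ l, Measurable (X l)) (hindep : iIndepFun X μ)
    (hlaw : ∀ l a b c, μ {ω | X l ω = (a, b, c)} = ENNReal.ofReal (q a b c))
    (f : Fin n × Fin n × Fin n → ℝ) :
    TendstoInDistribution
      (fun (N : ℕ) ω => (√(N : ℝ))⁻¹ * (∑ l ∈ Finset.range N, f (X l ω) -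
        N * ∫ ω, f (X 0 ω) ∂μ)) atTop (id : ℝ → ℝ) (fun _ => μ)
      (gaussianReal 0 Var[fun ω => f (X 0 ω); μ].toNNReal) := by
  have hf : Measurable f := measurable_of_finite f
  have hident : ∀ l, IdentDistrib (X l) (X 0) μ μ := fun l =>
    ⟨(hX l).aemeasurable, (hX 0).aemeasurable, Measure.ext_of_singleton fun ⟨a, b, c⟩ => by
      rw [Measure.map_apply (hX l) (measurableSet_singleton _),
        Measure.map_apply (hX 0) (measurableSet_singleton _)]
      exact (hlaw l a b c).trans (hlaw 0 a b c).symm⟩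
  have hbdd : MemLp (fun ω => f (X 0 ω)) 2 μ := by
    obtain ⟨C, hC⟩ := (Set.finite_range fun t => ‖f t‖).bddAbove
    exact MemLp.of_bound (hf.comp (hX 0)).aestronglyMeasurable C
      (Eventually.of_forall fun ω => hC ⟨X 0 ω, rfl⟩)
  exact tendstoInDistribution_inv_sqrt_mul_sum_sub (X := fun l ω => f (X l ω)) HasLaw.id hbdd
    (hindep.comp (fun _ => f) fun _ => hf) fun l => (hident l).comp hf

theorem sqrt_mul_sum_div_sub {N : ℕ} (hN : 1 ≤ N) (S m : ℝ) :
    √(N : ℝ) * (S / N - m) = (√(N : ℝ))⁻¹ * (S - N * m) := by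
  have h0 : (0 : ℝ) < N := by exact_mod_cast hN
  have hs := Real.sqrt_pos.2 h0
  have hss : √(N : ℝ) * √N = N := Real.mul_self_sqrt h0.le
  rw [eq_inv_mul_iff_mul_eq₀ hs.ne', ← mul_assoc, hss]
  field_simp

/-- The sum of the absolute deviations of two tables. -/
def tableDist (q' q : Fin n → Fin n → Fin n → ℝ) : ℝ :=
  ∑ a, ∑ b, ∑ c, |q' a b c - q a b c|

theorem tableDist_nonneg (q' q : Fin n → Fin n → Fin n → ℝ) : 0 ≤ tableDist q' q := by
  unfold tableDist
  positivity

theorem abs_sub_le_tableDist (q' q : Fin n → Fin n → Fin n → ℝ) (a b c : Fin n) :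
    |q' a b c - q a b c| ≤ tableDist q' q := by
  refine (Finset.single_le_sum (f := fun c => |q' a b c - q a b c|) (fun _ _ => abs_nonneg _)
    (Finset.mem_univ c)).trans ?_
  refine (Finset.single_le_sum (f := fun b => ∑ c, |q' a b c - q a b c|)
    (fun _ _ => by positivity) (Finset.mem_univ b)).trans ?_
  exact Finset.single_le_sum (f := fun a => ∑ b, ∑ c, |q' a b c - q a b c|)
    (fun _ _ => by positivity) (Finset.mem_univ a)

theorem boundedInProb_tableDist (hX : ∀ l, Measurable (X l)) (hindep : iIndepFun X μ)
    (hq : ∀ a b c, 0 ≤ q a b c)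
    (hlaw : ∀ l a b c, μ {ω | X l ω = (a, b, c)} = ENNReal.ofReal (q a b c)) :
    BoundedInProb μ fun N ω => √(N : ℝ) * tableDist (empiricalTable X N ω) q := by
  simp only [tableDist, Finset.mul_sum]
  refine BoundedInProb.sum _ fun a => BoundedInProb.sum _ fun b => BoundedInProb.sum _ fun c => ?_
  refine (boundedInProb_of_tendstoInDistribution (tendstoInDistribution_triple hX hindep hlaw
    fun t => if t = (a, b, c) then 1 else 0)).mono ?_
  filter_upwards [eventually_ge_atTop 1] with N hN ω
  have h1 : ∑ a', ∑ b', ∑ c', q a' b' c' * (if (a', b', c') = (a, b, c) then 1 else 0) =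
      q a b c := by
    rw [Finset.sum_eq_single a, Finset.sum_eq_single b, Finset.sum_eq_single c] <;>
      simp +contextual
  have hmean : ∫ ω, (if X 0 ω = (a, b, c) then (1 : ℝ) else 0) ∂μ = q a b c :=
    (integral_comp_triple hX hq hlaw (fun t => if t = (a, b, c) then 1 else 0) 0).trans h1
  rw [hmean, ← sqrt_mul_sum_div_sub hN, ← empiricalTable_eq, abs_mul, abs_mul, abs_abs]

/-- The indicator of x₁ = i is Bernoulli with mean strictly between 0 and 1, so its Gaussian limit
is nondegenerate. -/
theorem exists_P1_anticoncentration (hX : ∀ l, Measurable (X l)) (hindep : iIndepFun X μ)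
    (hq : ∀ a b c, 0 ≤ q a b c)
    (hlaw : ∀ l a b c, μ {ω | X l ω = (a, b, c)} = ENNReal.ofReal (q a b c))
    {i : Fin n} (h0 : 0 < P1 q i) (h1 : P1 q i < 1) :
    ∃ c : ℝ, 0 < c ∧ ∀ᶠ N : ℕ in atTop,
      ENNReal.ofReal c ≤ μ {ω | 1 < √(N : ℝ) * |P1 (empiricalTable X N ω) i - P1 q i|} := by
  set f : Fin n × Fin n × Fin n → ℝ := fun t => if t.1 = i then 1 else 0 with hf
  have hmean : ∫ ω, f (X 0 ω) ∂μ = P1 q i := by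
    rw [integral_comp_triple hX hq hlaw, Finset.sum_eq_single i] <;> simp +contextual [hf, P1]
  have hvar : Var[fun ω => f (X 0 ω); μ] ≠ 0 := by
    intro hv
    have hbdd : MemLp (fun ω => f (X 0 ω)) 2 μ := by
      obtain ⟨C, hC⟩ := (Set.finite_range fun t => ‖f t‖).bddAbove
      exact MemLp.of_bound ((measurable_of_finite f).comp (hX 0)).aestronglyMeasurable C
        (Eventually.of_forall fun ω => hC ⟨X 0 ω, rfl⟩)
    obtain ⟨ω, hω⟩ := (ae_eq_integral_of_variance_eq_zero hbdd hv).exists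
    rw [hmean] at hω
    by_cases hXi : (X 0 ω).1 = i
    · simp only [hf, hXi, if_true] at hω
      linarith
    · simp only [hf, hXi, if_false] at hω
      linarith
  have hclt := tendstoInDistribution_triple hX hindep hlaw f
  obtain ⟨c, hc, hev⟩ := exists_le_measure_of_tendstoInDistribution
    (Real.toNNReal_pos.2 ((variance_nonneg _ _).lt_of_ne' hvar)).ne' hclt
  refine ⟨c, hc, ?_⟩
  filter_upwards [hev, eventually_ge_atTop 1] with N hN hN1
  refine hN.trans (measure_mono fun ω hω => ?_)
  change 1 < √(N : ℝ) * |P1 (empiricalTable X N ω) i - P1 q i|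
  rw [Set.mem_ofPred_eq, hmean, ← sqrt_mul_sum_div_sub hN1, abs_mul,
    abs_of_nonneg (Real.sqrt_nonneg _)] at hω
  rwa [P1_empiricalTable]

end Sample

/-! ### Stochastic error bounds for the estimators -/

section Estimators

theorem HMM.tripleProb_nonneg {n m : ℕ} (M : HMM n m) (a b c : Fin n) :
    0 ≤ M.tripleProb a b c :=
  Finset.sum_nonneg fun _ _ => Finset.sum_nonneg fun _ _ => Finset.sum_nonneg fun _ _ =>
    mul_nonneg (mul_nonneg (mul_nonneg (mul_nonneg (mul_nonneg (M.init_nonneg _) (M.O_nonneg _ _))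
      (M.T_nonneg _ _)) (M.O_nonneg _ _)) (M.T_nonneg _ _)) (M.O_nonneg _ _)

variable {n k : ℕ}

/-- The entries of P₁ are the column sums of the nonnegative matrix P₂₁; a vanishing one would give
a zero column. -/
theorem P1_pos {q : Fin n → Fin n → Fin n → ℝ} (hq : ∀ a b c, 0 ≤ q a b c)
    (hdet : (P21 q).det ≠ 0) (j : Fin n) : 0 < P1 q j := by
  refine (Finset.sum_nonneg fun b _ => Finset.sum_nonneg fun c _ => hq j b c :
    0 ≤ P1 q j).lt_of_ne fun h => hdet ?_
  refine det_eq_zero_of_column_eq_zero j fun i => ?_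
  exact (Finset.sum_eq_zero_iff_of_nonneg fun b _ => Finset.sum_nonneg fun c _ => hq j b c).1
    h.symm i (Finset.mem_univ i)

theorem P1_lt_one {q : Fin n → Fin n → Fin n → ℝ} (hpos : ∀ j, 0 < P1 q j)
    (hsum : ∑ j, P1 q j = 1) (hn : 2 ≤ n) (i : Fin n) : P1 q i < 1 := by
  have : Nontrivial (Fin n) := Fin.nontrivial_iff_two_le.2 hn
  obtain ⟨j, hj⟩ := exists_ne i
  rw [← hsum]
  exact Finset.single_lt_sum hj (Finset.mem_univ i) (Finset.mem_univ j) (hpos j)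
    fun l _ _ => (hpos l).le

section Errors

variable {Ω : Type*} (X : ℕ → Ω → Fin n × Fin n × Fin n) (q : Fin n → Fin n → Fin n → ℝ)
  (B : Fin n → Matrix (Fin n) (Fin n) ℝ) (θ : ℕ → Ω → Factors n k) (N : ℕ) (ω : Ω)

theorem estimationError_eq :
    estimationError X q B θ N ω =
      √((∑ i, (P1 (empiricalTable X N ω) i - P1 q i) ^ 2) +
        familyDist (θ N ω).prod B ^ 2) := by
  rw [familyDist_sq]
  simp [estimationError, Triplet.distance, tripletOf, frobSq]

theorem estimationError_nonneg : 0 ≤ estimationError X q B θ N ω := Real.sqrt_nonneg _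

theorem abs_P1_sub_le_estimationError (i : Fin n) :
    |P1 (empiricalTable X N ω) i - P1 q i| ≤ estimationError X q B θ N ω := by
  rw [estimationError_eq]
  refine Real.abs_le_sqrt ?_
  have := Finset.single_le_sum (f := fun i => (P1 (empiricalTable X N ω) i - P1 q i) ^ 2)
    (fun _ _ => sq_nonneg _) (Finset.mem_univ i)
  linarith [sq_nonneg (familyDist (θ N ω).prod B)]

theorem familyDist_le_estimationError :
    familyDist (θ N ω).prod B ≤ estimationError X q B θ N ω := by
  rw [estimationError_eq]
  refine Real.le_sqrt_of_sq_le ?_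
  linarith [(Finset.sum_nonneg fun i _ => sq_nonneg _ :
    0 ≤ ∑ i, (P1 (empiricalTable X N ω) i - P1 q i) ^ 2)]

theorem estimationError_le :
    estimationError X q B θ N ω ≤
      tableDist (empiricalTable X N ω) q + familyDist (θ N ω).prod B := by
  have ht := tableDist_nonneg (empiricalTable X N ω) q
  have hd := familyDist_nonneg (θ N ω).prod B
  have habs : ∀ i, |P1 (empiricalTable X N ω) i - P1 q i| ≤
      ∑ b, ∑ c, |empiricalTable X N ω i b c - q i b c| := fun i => by
    simp only [P1, ← Finset.sum_sub_distrib]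
    exact (Finset.abs_sum_le_sum_abs _ _).trans
      (Finset.sum_le_sum fun b _ => Finset.abs_sum_le_sum_abs _ _)
  have h1 : ∑ i, (P1 (empiricalTable X N ω) i - P1 q i) ^ 2 ≤
      tableDist (empiricalTable X N ω) q ^ 2 := by
    calc _ = ∑ i, |P1 (empiricalTable X N ω) i - P1 q i| ^ 2 := by simp only [sq_abs]
      _ ≤ (∑ i, |P1 (empiricalTable X N ω) i - P1 q i|) ^ 2 :=
        Finset.sum_sq_le_sq_sum_of_nonneg fun i _ => abs_nonneg _
      _ ≤ _ := pow_le_pow_left₀ (by positivity) (Finset.sum_le_sum fun i _ => habs i) 2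
  rw [estimationError_eq]
  refine Real.sqrt_le_iff.2 ⟨by linarith, ?_⟩
  nlinarith [mul_nonneg ht hd]

end Errors

variable {Ω : Type*} [MeasurableSpace Ω] {μ : Measure Ω}
  {X : ℕ → Ω → Fin n × Fin n × Fin n} {q : Fin n → Fin n → Fin n → ℝ}
  {B : Fin n → Matrix (Fin n) (Fin n) ℝ} {P : Factors n k → ℝ}

/-- Minimisers of the empirical criterion with penalty weights `O(N^{-1/2})` have errors
`O_P(N^{-1/2})`. -/
theorem boundedInProb_sqrt_mul_estimationError
    (hB : IsLowRankTarget k q B) (hk : 0 < k) (hrank : ∀ x, (B x).rank = k)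
    (hLip : LocallyLipschitz P) (hproper : IsProperPenalty P)
    (htable : BoundedInProb μ fun N ω => √(N : ℝ) * tableDist (empiricalTable X N ω) q)
    {τ : ℕ → ℝ} {L : ℝ} (hτ0 : ∀ N, 0 ≤ τ N) (hτ : ∀ᶠ N : ℕ in atTop, √(N : ℝ) * τ N ≤ L)
    {θ : ℕ → Ω → Factors n k}
    (hθ : Tendsto (fun N => μ {ω | ¬ IsMinimizer
      (fun ζ => criterion (empiricalTable X N ω) ζ + τ N * P ζ) (θ N ω)}) atTop (𝓝 0)) :
    BoundedInProb μ (fun N ω => √(N : ℝ) * estimationError X q B θ N ω) := by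
  obtain ⟨C, δ, hC, hδ, hbound⟩ := exists_minimizer_error_bound hB hk hrank hLip hproper
  intro ε hε
  obtain ⟨K, hK⟩ := htable (ε / 2) (half_pos hε)
  have hε' : (0 : ENNReal) < ENNReal.ofReal (ε / 2) := ENNReal.ofReal_pos.2 (half_pos hε)
  have hsqrt : Tendsto (fun N : ℕ => √(N : ℝ)) atTop atTop :=
    Real.tendsto_sqrt_atTop.comp tendsto_natCast_atTop_atTop
  refine ⟨K + C * (K + L), ?_⟩
  filter_upwards [hK, hθ.eventually_lt_const hε', hτ, hsqrt.eventually_ge_atTop (K / δ),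
    hsqrt.eventually_ge_atTop (L / δ), hsqrt.eventually_gt_atTop 0] with N h1 h2 h3 h4 h5 hs
  rw [div_le_iff₀ hδ] at h4 h5
  -- Outside two events of small probability the deterministic bound applies. Only monotonicity and
  -- subadditivity of μ are used, so the estimators need not be measurable.
  have hsub : {ω | K + C * (K + L) < |√(N : ℝ) * estimationError X q B θ N ω|} ⊆
      {ω | K < |√(N : ℝ) * tableDist (empiricalTable X N ω) q|} ∪ {ω | ¬ IsMinimizer
        (fun ζ => criterion (empiricalTable X N ω) ζ + τ N * P ζ) (θ N ω)} := by
    intro ω hω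
    by_contra hcon
    rw [Set.mem_union, not_or] at hcon
    have h6 : √(N : ℝ) * tableDist (empiricalTable X N ω) q ≤ K :=
      (le_abs_self _).trans (not_lt.1 hcon.1)
    have hmin : IsMinimizer (fun ζ => criterion (empiricalTable X N ω) ζ + τ N * P ζ) (θ N ω) :=
      not_not.1 hcon.2
    have hω' : K + C * (K + L) < |√(N : ℝ) * estimationError X q B θ N ω| := hω
    rw [abs_of_nonneg (mul_nonneg hs.le (estimationError_nonneg X q B θ N ω))] at hω'
    have h7 := hbound (empiricalTable X N ω) (tableDist (empiricalTable X N ω) q) (τ N) (θ N ω)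
      (tableDist_nonneg _ _) (le_of_mul_le_mul_left (h6.trans h4) hs) (hτ0 N)
      (le_of_mul_le_mul_left (h3.trans h5) hs) (fun a b c => abs_sub_le_tableDist _ _ a b c) hmin
    have h8 := mul_le_mul_of_nonneg_left ((estimationError_le X q B θ N ω).trans
      (add_le_add_right h7 _)) hs.le
    have h9 := mul_le_mul_of_nonneg_left (add_le_add h6 h3) hC
    nlinarith
  refine (measure_mono hsub).trans ((measure_union_le _ _).trans ((add_le_add h1 h2.le).trans ?_))
  rw [← ENNReal.ofReal_add (by linarith) (by linarith), add_halves]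

/-- Minimisers with a penalty decaying more slowly than `N^{-1/2}` do not have errors
`O_P(N^{-1/2})`. -/
theorem not_boundedInProb_sqrt_mul_estimationError [IsProbabilityMeasure μ]
    (hB : IsLowRankTarget k q B) (hrank : ∀ x, (B x).rank = k)
    (hLip : LocallyLipschitz P) (hproper : IsProperPenalty P)
    (hdesc : ∀ θ : Factors n k, IsCheapestFactorization P B θ → HasDescentDirection P θ)
    (htable : BoundedInProb μ fun N ω => √(N : ℝ) * tableDist (empiricalTable X N ω) q)
    {lam p : ℝ} (hlam : 0 < lam) (hp : p < 1 / 2) {θ : ℕ → Ω → Factors n k}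
    (hθ : Tendsto (fun N => μ {ω | ¬ IsMinimizer
      (penalizedCriterion (empiricalTable X N ω) P lam p N) (θ N ω)}) atTop (𝓝 0)) :
    ¬ BoundedInProb μ (fun N ω => √(N : ℝ) * estimationError X q B θ N ω) := by
  intro herr
  -- Three exceptional events of probability at most 1/4 do not cover Ω. For each large N a single
  -- remaining ω supplies the table and the minimiser that the deterministic lemma excludes.
  obtain ⟨K₁, hK₁⟩ := htable (1 / 4) (by norm_num)
  obtain ⟨K₂, hK₂⟩ := herr (1 / 4) (by norm_num)
  refine not_eventually_exists_fast_minimizer hB hrank hLip hproper hdesc hlam hp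
    (K := max (max K₁ K₂) 0) (le_max_right _ _) ?_
  have hε : (0 : ENNReal) < ENNReal.ofReal (1 / 4) := ENNReal.ofReal_pos.2 (by norm_num)
  filter_upwards [hK₁, hK₂, hθ.eventually_lt_const hε, eventually_ge_atTop 1] with N h1 h2 h3 hN
  have hs : 0 < √(N : ℝ) := Real.sqrt_pos.2 (by exact_mod_cast hN)
  set E₁ := {ω | K₁ < |√(N : ℝ) * tableDist (empiricalTable X N ω) q|}
  set E₂ := {ω | K₂ < |√(N : ℝ) * estimationError X q B θ N ω|}
  set E₃ := {ω | ¬ IsMinimizer (penalizedCriterion (empiricalTable X N ω) P lam p N) (θ N ω)}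
  obtain ⟨ω, hω⟩ : ∃ ω, ω ∉ (E₁ ∪ E₂) ∪ E₃ := by
    by_contra! hall
    have huniv : (E₁ ∪ E₂) ∪ E₃ = Set.univ := Set.eq_univ_of_forall hall
    have hle : μ ((E₁ ∪ E₂) ∪ E₃) ≤
        ENNReal.ofReal (1 / 4) + ENNReal.ofReal (1 / 4) + ENNReal.ofReal (1 / 4) :=
      (measure_union_le _ _).trans
        (add_le_add ((measure_union_le _ _).trans (add_le_add h1 h2)) h3.le)
    rw [huniv, measure_univ, ← ENNReal.ofReal_add (by norm_num) (by norm_num),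
      ← ENNReal.ofReal_add (by norm_num) (by norm_num), ENNReal.one_le_ofReal] at hle
    norm_num at hle
  rw [Set.mem_union, Set.mem_union, not_or, not_or] at hω
  have h4 : √(N : ℝ) * tableDist (empiricalTable X N ω) q ≤ K₁ :=
    (le_abs_self _).trans (not_lt.1 hω.1.1)
  have h5 : √(N : ℝ) * estimationError X q B θ N ω ≤ K₂ :=
    (le_abs_self _).trans (not_lt.1 hω.1.2)
  refine ⟨empiricalTable X N ω, θ N ω, fun a b c => ?_, ?_, not_not.1 hω.2⟩
  · refine (abs_sub_le_tableDist _ _ a b c).trans ?_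
    rw [le_div_iff₀ hs, mul_comm]
    exact h4.trans ((le_max_left _ _).trans (le_max_left _ _))
  · refine (familyDist_le_estimationError X q B θ N ω).trans ?_
    rw [le_div_iff₀ hs, mul_comm]
    exact h5.trans ((le_max_right _ _).trans (le_max_left _ _))

theorem HasRate.sameRate {Z Z' : ℕ → Ω → ℝ} {r : ℕ → ℝ} (h : HasRate μ Z r)
    (h' : HasRate μ Z' r) : SameRate μ Z Z' := fun s => (h s).trans (h' s).symm

end Estimators

end

/-! ### The exact rate and the critical exponent -/

theorem proposition2 {n m k : ℕ} (hkm : k < m)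
    -- the hidden Markov model, with its standing assumptions
    (M : HMM n m) (hT : M.T.rank = m) (hO : M.O.rank = m) (hinit : ∀ h, 0 < M.init h)
    -- the identified low-rank target, at which the rank constraint is tight
    (B : Fin n → Matrix (Fin n) (Fin n) ℝ)
    (hB : IsLowRankTarget k M.tripleProb B) (hrank : ∀ x, (B x).rank = k)
    -- the penalty
    (P : Factors n k → ℝ) (lam : ℝ) (hlam : 0 < lam)
    (hLip : LocallyLipschitz P) (hproper : IsProperPenalty P)
    (hdesc : ∀ θ : Factors n k, IsCheapestFactorization P B θ → HasDescentDirection P θ)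
    -- independent observed triplets
    {Ω : Type*} [MeasurableSpace Ω] (μ : Measure Ω) [IsProbabilityMeasure μ]
    (X : ℕ → Ω → Fin n × Fin n × Fin n) (hX : ∀ l, Measurable (X l)) (hindep : iIndepFun X μ)
    (hlaw : ∀ l a b c, μ {ω | X l ω = (a, b, c)} = ENNReal.ofReal (M.tripleProb a b c))
    -- the unpenalised estimator, and the penalised one for each exponent `p`
    (θ₀ : ℕ → Ω → Factors n k)
    (hθ₀ : Tendsto (fun N => μ {ω | ¬ IsMinimizer (criterion (empiricalTable X N ω)) (θ₀ N ω)})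
      atTop (𝓝 0))
    (θp : ℝ → ℕ → Ω → Factors n k)
    (hθp : ∀ p : ℝ, 0 < p → Tendsto (fun N => μ {ω | ¬ IsMinimizer
      (penalizedCriterion (empiricalTable X N ω) P lam p N) (θp p N ω)}) atTop (𝓝 0)) :
    HasRate μ (estimationError X M.tripleProb B θ₀) (fun N => Real.sqrt N) ∧
      IsLeast {p : ℝ | 0 < p ∧ SameRate μ (estimationError X M.tripleProb B (θp p))
        (estimationError X M.tripleProb B θ₀)} (1 / 2) ∧
      ∀ p : ℝ, 0 < p → (SameRate μ (estimationError X M.tripleProb B (θp p))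
        (estimationError X M.tripleProb B θ₀) ↔ 1 / 2 ≤ p) := by
  have hk := pos_of_hasDescentDirection hB hdesc
  have hq := M.tripleProb_nonneg
  have hdet := det_P21_ne_zero hB hk hrank
  -- n ≥ m > k ≥ 1. With two positive entries summing with the others to 1, no entry of P₁ equals 1.
  have hn : 2 ≤ n := by
    have := hO ▸ Matrix.rank_le_height M.O
    omega
  have hsum : ∑ j, P1 M.tripleProb j = 1 := by
    have h := integral_comp_triple hX hq hlaw (fun _ => 1) 0
    simp only [integral_const, probReal_univ, smul_eq_mul, mul_one] at h
    exact h.symm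
  have hpos := P1_pos hq hdet
  have htable := boundedInProb_tableDist hX hindep hq hlaw
  obtain ⟨c, hc, hanti⟩ := exists_P1_anticoncentration hX hindep hq hlaw
    (hpos ⟨0, by omega⟩) (P1_lt_one hpos hsum hn _)
  -- The lower bound comes from P̂₁ alone, so it holds for every choice of factors; only the upper
  -- bound depends on the penalty.
  have hrate : ∀ θ : ℕ → Ω → Factors n k,
      BoundedInProb μ (fun N ω => √(N : ℝ) * estimationError X M.tripleProb B θ N ω) →
      HasRate μ (estimationError X M.tripleProb B θ) (fun N => Real.sqrt N) := by
    intro θ hup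
    refine hasRate_sqrt hup one_pos hc ?_
    filter_upwards [hanti] with N hN
    refine hN.trans (measure_mono fun ω hω => ?_)
    refine lt_of_lt_of_le (b := √(N : ℝ) * |P1 (empiricalTable X N ω) _ - P1 M.tripleProb _|) hω ?_
    rw [abs_of_nonneg (estimationError_nonneg X M.tripleProb B θ N ω)]
    exact mul_le_mul_of_nonneg_left (abs_P1_sub_le_estimationError X M.tripleProb B θ N ω _)
      (Real.sqrt_nonneg _)
  have hrate₀ : HasRate μ (estimationError X M.tripleProb B θ₀) (fun N => Real.sqrt N) := by
    -- The unpenalised criterion is the case of weight zero.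
    refine hrate θ₀ (boundedInProb_sqrt_mul_estimationError hB hk hrank hLip hproper htable
      (τ := fun _ => 0) (L := 0) (fun _ => le_rfl) (Eventually.of_forall fun N => by simp) ?_)
    simpa only [zero_mul, add_zero] using hθ₀
  have hiff : ∀ p : ℝ, 0 < p → (SameRate μ (estimationError X M.tripleProb B (θp p))
      (estimationError X M.tripleProb B θ₀) ↔ 1 / 2 ≤ p) := by
    intro p hp
    constructor
    · intro hsame
      by_contra! hlt
      exact not_boundedInProb_sqrt_mul_estimationError hB hrank hLip hproper hdesc htable hlam hlt
        (hθp p hp) ((hsame fun N => √(N : ℝ)).2 ((hrate₀ _).2 (Asymptotics.isBigO_refl _ _)))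
    · intro hle
      refine (hrate (θp p) (boundedInProb_sqrt_mul_estimationError hB hk hrank hLip hproper htable
        (τ := fun N => lam * (N : ℝ) ^ (-p)) (L := lam) (fun N => by positivity) ?_
        (hθp p hp))).sameRate hrate₀
      filter_upwards [eventually_ge_atTop 1] with N hN
      have hN1 : (1 : ℝ) ≤ N := by exact_mod_cast hN
      have h1 : √(N : ℝ) * (N : ℝ) ^ (-p) ≤ 1 := by
        rw [Real.sqrt_eq_rpow, ← Real.rpow_add (by linarith)]
        exact Real.rpow_le_one_of_one_le_of_nonpos hN1 (by linarith)
      calc √(N : ℝ) * (lam * (N : ℝ) ^ (-p)) = lam * (√(N : ℝ) * (N : ℝ) ^ (-p)) := by ring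
        _ ≤ lam * 1 := mul_le_mul_of_nonneg_left h1 hlam.le
        _ = lam := mul_one _
  exact ⟨hrate₀, ⟨⟨by norm_num, (hiff _ (by norm_num)).2 le_rfl⟩, fun p hp => (hiff p hp.1).1 hp.2⟩,
    hiff⟩
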